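/- **Setting.** For $M>0$ let $\Omega_M=\mathbb R\times[0,M]$; functions are complex-valued, $L^2(\Omega_M)=L^2_x(\mathbb R;L^2_y(0,M))$, and for $s\ge 0$ let $|\partial_x|^s=\mathcal F_x^{-1}|\xi|^s\mathcal F_x$ be the Fourier multiplier in $x$ (where $\partial_x$ has symbol $i\xi$). For $s\ge0$, $H^s_xL^2_y=H^s(\mathbb R;L^2(0,M))$. For $\bar\alpha\ge 0$ put $$\|f\|_{Y_{\bar\alpha}}=\big\|y|\partial_x|^{\frac{\bar\alpha}2}\partial_xf\big\|_{L^2(\Omega_M)}+\big\||\partial_x|^{\frac23+\frac{\bar\alpha}2}f\big\|_{L^2(\Omega_M)}+\big\||\partial_x|^{\frac13+\frac{\bar\alpha}2}\partial_yf\big\|_{L^2(\Omega_M)}+\big\||\partial_x|^{\frac{\bar\alpha}2}\partial_y^2f\big\|_{L^2(\Omega_M)}+\big\||\partial_x|^{\frac{1+\bar\alpha}2}y^{\frac12}\partial_yf\big\|_{L^2(\Omega_M)},$$ $$\|f\|_{X_{\bar\alpha}}=\|f\|_{L^2(\Omega_M)}+\big\||\partial_x|^{\frac1{18}}y^{\frac16}f\big\|_{L^2(\Omega_M)}+\|f\|_{Y_{\bar\alpha}},\qquad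 X_{\bar\alpha}=\{f:\ \|f\|_{X_{\bar\alpha}}<\infty\},$$ and $\|f\|_{X_0\cap X_\alpha}=\|f\|_{X_0}+\|f\|_{X_\alpha}$. **Lemma.** There is an absolute constant $C$ such that for all $\alpha>0$, all $M>0$ and all $h_e\in H^{\alpha/2}_xL^2_y$ the following holds. The problem $$y\,\partial_xf_e-\partial_y^2f_e=h_e\ \text{ in }\Omega_M,\qquad \partial_yf_e\big|_{y=0}=0,\qquad f_e\big|_{y=M}=0,$$ has a unique solution $f_e\in X_0\cap X_\alpha$ (the equation is understood with weak derivatives, as an identity in $L^2(\Omega_M)$, and the boundary conditions as traces for almost every $x$), and $$\|f_e\|_{X_0\cap X_\alpha}\le C\big[(1+M^2)\|h_e\|_{L^2(\Omega_M)}+\||\partial_x|^{\frac\alpha2}h_e\|_{L^2(\Omega_M)}\big].$$ In particular $C$ is independent of $\alpha$, $M$ and $h_e$. -/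

import Mathlib

open MeasureTheory Set
open scoped ENNReal NNReal ContDiff FourierTransform SchwartzMap LineDeriv

noncomputable section

namespace TripleDeck

/-- The space `L²_y(0,M)` of complex-valued functions of the vertical variable. -/
abbrev L2y (M : ℝ) : Type := Lp ℂ 2 (volume.restrict (Ioo (0 : ℝ) M))

/-- The space `L²(Ω_M) = L²_x(ℝ; L²_y(0,M))` on the strip `Ω_M = ℝ × [0,M]`. For `f : L2Strip M`
the value `f(x,y)` is `f x y`. The Fourier transform `𝓕 f : L2Strip M` is the (Plancherel)
Fourier transform in the horizontal variable `x`, normalised by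
`𝓕 f (ξ) = ∫ exp(-2πixξ) f(x) dx`; it is an isometry of `L2Strip M`. -/
abbrev L2Strip (M : ℝ) : Type := Lp (L2y M) 2 (volume : Measure ℝ)

/-- `v = ∂_y^j u` in the sense of distributions on `(0,M)`. -/
def HasWeakDeriv (M : ℝ) (j : ℕ) (u v : L2y M) : Prop :=
  ∀ φ : ℝ → ℂ, ContDiff ℝ ∞ φ → HasCompactSupport φ → tsupport φ ⊆ Ioo 0 M →
    ∫ y in Ioo 0 M, iteratedDeriv j φ y * u y = (-1) ^ j * ∫ y in Ioo 0 M, φ y * v y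

/-- `u` has a representative that is continuous on `[0,M]` and takes the value `c` at `a`
(used for the end points `a = 0` and `a = M`). -/
def HasTrace (M : ℝ) (u : L2y M) (a : ℝ) (c : ℂ) : Prop :=
  ∃ U : ℝ → ℂ, ContinuousOn U (Icc 0 M) ∧ (∀ᵐ y ∂volume.restrict (Ioo 0 M), u y = U y) ∧ U a = c

/-- `(∫_ℝ ∫_0^M | |2πξ|^s y^k g(ξ,y) |² dy dξ)^{1/2}`, possibly infinite. The factor `2πξ` is the
angular frequency, i.e. `2πiξ` is the Fourier symbol of `∂_x`. -/
def freqNorm (M s k : ℝ) (g : ℝ → L2y M) : ℝ≥0∞ :=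
  (∫⁻ ξ : ℝ, ∫⁻ y in Ioo 0 M,
    ‖(((|2 * Real.pi * ξ| ^ s * y ^ k : ℝ) : ℂ)) * g ξ y‖ₑ ^ 2) ^ (1 / 2 : ℝ)

/-- `‖ |∂_x|^s y^k f ‖_{L²(Ω_M)}`, where `|∂_x|^s` is the Fourier multiplier with symbol `|·|^s`
(computed on the Fourier side by Plancherel's theorem). -/
def fracNorm {M : ℝ} (s k : ℝ) (f : L2Strip M) : ℝ≥0∞ :=
  freqNorm M s k (𝓕 f : L2Strip M)

/-- `‖ |∂_x|^s y^k ∂_y^j f ‖_{L²(Ω_M)}`, computed on the Fourier side: `g(ξ,·)` is the weak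
derivative `∂_y^j (𝓕 f)(ξ,·)`. It is unique for almost every `ξ`, so the infimum is over
at most one (class of) `g`; the value is `∞` if there is no such `g`. -/
def fracDerivNorm {M : ℝ} (s k : ℝ) (j : ℕ) (f : L2Strip M) : ℝ≥0∞ :=
  ⨅ (g : ℝ → L2y M) (_ : AEStronglyMeasurable g volume)
    (_ : ∀ᵐ ξ, HasWeakDeriv M j ((𝓕 f : L2Strip M) ξ) (g ξ)), freqNorm M s k g

/-- The norm of the high-frequency space `Y_a`. The first summand is
`‖ y |∂_x|^{a/2} ∂_x f ‖`, whose Fourier symbol has modulus `|2πξ|^{1 + a/2} y`. -/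
def normY {M : ℝ} (a : ℝ) (f : L2Strip M) : ℝ≥0∞ :=
  fracNorm (1 + a / 2) 1 f
    + fracNorm (2 / 3 + a / 2) 0 f
    + fracDerivNorm (1 / 3 + a / 2) 0 1 f
    + fracDerivNorm (a / 2) 0 2 f
    + fracDerivNorm ((1 + a) / 2) (1 / 2) 1 f

/-- The norm of the space `X_a`; `f ∈ X_a` means that it is finite. -/
def normX {M : ℝ} (a : ℝ) (f : L2Strip M) : ℝ≥0∞ :=
  ‖f‖ₑ + fracNorm (1 / 18) (1 / 6) f + normY a f

/-- The norm of `X_a ∩ X_b`. -/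
def normXInter {M : ℝ} (a b : ℝ) (f : L2Strip M) : ℝ≥0∞ :=
  normX a f + normX b f

/-- Membership in `X_a ∩ X_b`. -/
def MemXInter {M : ℝ} (a b : ℝ) (f : L2Strip M) : Prop :=
  normX a f < ⊤ ∧ normX b f < ⊤

/-- `f` solves `y ∂_x f - ∂_y² f = h` in `Ω_M`, `∂_y f = 0` on `y = 0`, `f = 0` on `y = M`. -/
structure IsSolution {M : ℝ} (f h : L2Strip M) : Prop where
  /-- With `w = y f` and `q = ∂_y² f ∈ L²(Ω_M)`, one has `∂_x w = q + h`, where `∂_x` is the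
  derivative of `L²_y`-valued tempered distributions on `ℝ`. -/
  eqn : ∃ w q : L2Strip M,
    (∀ᵐ x, ∀ᵐ y ∂volume.restrict (Ioo 0 M), w x y = (y : ℂ) * f x y) ∧
    (∀ᵐ x, HasWeakDeriv M 2 (f x) (q x)) ∧
    ∂_{(1 : ℝ)} (w : 𝓢'(ℝ, L2y M)) = ((q + h : L2Strip M) : 𝓢'(ℝ, L2y M))
  /-- `∂_y f` vanishes on `y = 0`. -/
  neumann : ∃ g : L2Strip M, (∀ᵐ x, HasWeakDeriv M 1 (f x) (g x)) ∧ ∀ᵐ x, HasTrace M (g x) 0 0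
  /-- `f` vanishes on `y = M`. -/
  dirichlet : ∀ᵐ x, HasTrace M (f x) M 0

end TripleDeck

end

/-!
On the Fourier side, with `t = 2πξ`, the problem reads `i t y F - F'' = H` on `(0,M)`, `F'(0) = 0`,
`F(M) = 0`, for one frequency at a time. Let `J u = ∫_0^y u` (`primL`), `K u = -∫_y^M u` (`primR`)
and let `Y` be multiplication by `y` (`weight M 1`). A weak derivative together with a vanishing
trace is the same as a primitive (`eq_primL_of_hasWeakDeriv`, `eq_primR_of_hasWeakDeriv`), so that
the problem says `F = K g`, `g = J q`, `q = i t Y F - H`. Since `K = -J*`, this is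
`(1 + i t K* Y K) g = -J H`; as `K* Y K` is self-adjoint, `g` is uniquely determined and depends
continuously on `t` (`eq_flux_iff`, `continuous_flux`), which gives the measurability in `ξ`.
Bounded operators in `y` commute with the Fourier transform in `x` (`fourier_compLpL`), and this
moves equation, traces and weak derivatives between the two sides (`IsFlux.isSolution`,
`IsSolution.exists_isFlux`).

The estimates use only the commutation `Y K g = K (K g + Y g) = J (K g + Y g)` and `K = -J*`.
Pairing `q` with `F` and with `Y F`, and pairing `F` with itself, gives for
`A = ‖F‖`, `B = ‖√y F‖`, `G = ‖g‖`, `D = ‖√y g‖`, `E = ‖y F‖`, `h = ‖H‖` the inequalities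
`G² ≤ h A`, `|t| B² ≤ h A`, `A² ≤ 2 B D`, `|t| E² ≤ h E + A G`, `D² ≤ h E + A G`.
They are invariant under the scaling of the equation and bound `|t|^(2/3) A`, `|t|^(1/3) G`,
`|t| E`, `|t|^(1/2) D` and `‖q‖` by multiples of `h` (`frequency_bounds`, `norm_curvature_le`).
The low-order terms come from `A ≤ M G`, which gives `A ≤ M² h`; the exponents `1/18`, `1/6` are
those at which interpolating it against `|t|^(2/3) A ≤ 4 h` leaves exactly `M² h`
(`norm_weight_sixth_le`).
-/

noncomputable section

namespace TripleDeck

/-! ### The Fourier transform in the horizontal variable -/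

section Fourier

variable {E : Type*} [NormedAddCommGroup E] [InnerProductSpace ℂ E]

theorem integrable_schwartz_smul (φ : 𝓢(ℝ, ℂ)) (u : Lp E 2 (volume : Measure ℝ)) :
    Integrable (fun x ↦ φ x • u x) := by
  have h1 : MemLp (fun x ↦ φ x) 2 (volume : Measure ℝ) := φ.memLp 2 volume
  rw [← memLp_one_iff_integrable]
  exact (Lp.memLp u).smul h1

variable [CompleteSpace E]
variable {F : Type*} [NormedAddCommGroup F] [InnerProductSpace ℂ F] [CompleteSpace F]

/-- For square-integrable `u`, `v`, the identity `σ u = v` of tempered distributions holds almost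
everywhere. -/
theorem smulLeftCLM_eq_iff {σ : ℝ → ℂ} (hσ : σ.HasTemperateGrowth)
    (u v : Lp E 2 (volume : Measure ℝ)) :
    TemperedDistribution.smulLeftCLM E σ (u : 𝓢'(ℝ, E)) = (v : 𝓢'(ℝ, E)) ↔
      ∀ᵐ x, σ x • u x = v x := by
  have key (φ : 𝓢(ℝ, ℂ)) : TemperedDistribution.smulLeftCLM E σ (u : 𝓢'(ℝ, E)) φ
      = ∫ x, φ x • σ x • u x := by
    rw [TemperedDistribution.smulLeftCLM_apply_apply, Lp.toTemperedDistribution_apply]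
    congr 1 with x
    rw [SchwartzMap.smulLeftCLM_apply_apply hσ, smul_smul, smul_eq_mul, mul_comm]
  constructor
  · intro h
    have hu : LocallyIntegrable (u : ℝ → E) :=
      (Lp.memLp u).locallyIntegrable (by norm_num)
    have hv : LocallyIntegrable (v : ℝ → E) :=
      (Lp.memLp v).locallyIntegrable (by norm_num)
    have hσu : LocallyIntegrable (fun x ↦ σ x • u x) := by
      rw [← locallyIntegrableOn_univ] at hu ⊢
      exact hu.continuousOn_smul isClosed_univ.isLocallyClosed hσ.1.continuous.continuousOn
    refine ae_eq_of_integral_contDiff_smul_eq hσu hv fun g hg hgs ↦ ?_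
    have hgc : HasCompactSupport (fun x ↦ (g x : ℂ)) := hgs.comp_left Complex.ofReal_zero
    have hgd : ContDiff ℝ ∞ (fun x ↦ (g x : ℂ)) := Complex.ofRealCLM.contDiff.comp hg
    have := congrArg (fun T ↦ T (hgc.toSchwartzMap hgd)) h
    simp only [key, Lp.toTemperedDistribution_apply] at this
    simpa using this
  · intro h
    ext φ
    rw [key, Lp.toTemperedDistribution_apply]
    refine integral_congr_ae ?_
    filter_upwards [h] with x hx
    rw [hx]

theorem eq_of_toTemperedDistribution_eq {u v : Lp E 2 (volume : Measure ℝ)}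
    (h : (u : 𝓢'(ℝ, E)) = (v : 𝓢'(ℝ, E))) : u = v := by
  have h1 := (smulLeftCLM_eq_iff (σ := fun _ ↦ (1 : ℂ)) (by fun_prop) u v).1 (by simpa using h)
  refine Lp.ext ?_
  filter_upwards [h1] with x hx
  simpa using hx

/-- Bounded operators acting on the values commute with the Plancherel Fourier transform. -/
theorem fourier_compLpL (T : E →L[ℂ] F) (u : Lp E 2 (volume : Measure ℝ)) :
    𝓕 (T.compLpL 2 volume u) = T.compLpL 2 volume (𝓕 u) := by
  have key (w : Lp E 2 (volume : Measure ℝ)) (φ : 𝓢(ℝ, ℂ)) :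
      ((T.compLpL 2 volume w : Lp F 2 volume) : 𝓢'(ℝ, F)) φ = T ((w : 𝓢'(ℝ, E)) φ) := by
    rw [Lp.toTemperedDistribution_apply, Lp.toTemperedDistribution_apply,
      ← T.integral_comp_comm (integrable_schwartz_smul φ w)]
    refine integral_congr_ae ?_
    filter_upwards [T.coeFn_compLpL w] with x hx
    rw [hx, map_smul]
  refine eq_of_toTemperedDistribution_eq ?_
  ext φ
  rw [key, ← Lp.fourier_toTemperedDistribution_eq, ← Lp.fourier_toTemperedDistribution_eq,
    TemperedDistribution.fourier_apply, TemperedDistribution.fourier_apply, key]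

/-- `∂_x w = v` as tempered distributions if and only if `2πiξ ŵ = v̂` almost everywhere. -/
theorem lineDeriv_eq_iff (w v : Lp E 2 (volume : Measure ℝ)) :
    ∂_{(1 : ℝ)} (w : 𝓢'(ℝ, E)) = (v : 𝓢'(ℝ, E)) ↔
      ∀ᵐ ξ : ℝ,
        (2 * Real.pi * ξ * Complex.I) • (𝓕 w : Lp E 2 volume) ξ = (𝓕 v : Lp E 2 volume) ξ := by
  have h1 : ∂_{(1 : ℝ)} (w : 𝓢'(ℝ, E)) = (v : 𝓢'(ℝ, E)) ↔
      𝓕 (∂_{(1 : ℝ)} (w : 𝓢'(ℝ, E))) = 𝓕 (v : 𝓢'(ℝ, E)) := by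
    refine ⟨fun h ↦ by rw [h], fun h ↦ ?_⟩
    have h2 := congrArg (fun T : 𝓢'(ℝ, E) ↦ (𝓕⁻ T : 𝓢'(ℝ, E))) h
    simpa only [FourierTransform.fourierInv_fourier_eq] using h2
  have hσ : (fun x : ℝ ↦ ((inner ℝ x (1 : ℝ) : ℝ) : ℂ)).HasTemperateGrowth := by fun_prop
  have hσ' : (fun ξ : ℝ ↦ (2 * Real.pi * ξ * Complex.I)).HasTemperateGrowth := by fun_prop
  rw [h1, TemperedDistribution.fourier_lineDerivOp_eq, Lp.fourier_toTemperedDistribution_eq,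
    Lp.fourier_toTemperedDistribution_eq, ← smulLeftCLM_eq_iff hσ']
  have h2 : TemperedDistribution.smulLeftCLM E (fun ξ : ℝ ↦ (2 * Real.pi * ξ * Complex.I)) =
      (2 * Real.pi * Complex.I) • TemperedDistribution.smulLeftCLM E
        (fun x : ℝ ↦ ((inner ℝ x (1 : ℝ) : ℝ) : ℂ)) := by
    rw [← TemperedDistribution.smulLeftCLM_smul hσ]
    congr 1
    ext x
    simp
    ring
  rw [h2]
  rfl

theorem exists_rpow_smul_fourier_of_memSobolev {s : ℝ} {h : Lp E 2 (volume : Measure ℝ)}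
    (hh : TemperedDistribution.MemSobolev s 2 (h : 𝓢'(ℝ, E))) :
    ∃ g : Lp E 2 (volume : Measure ℝ),
      ∀ᵐ ξ, (((1 + ‖ξ‖ ^ 2) ^ (s / 2) : ℝ) : ℂ) • (𝓕 h : Lp E 2 volume) ξ = g ξ := by
  obtain ⟨g, hg⟩ := TemperedDistribution.memSobolev_iff_exists_smulLeftCLM_fourier.1 hh
  rw [Lp.fourier_toTemperedDistribution_eq] at hg
  exact ⟨g, (smulLeftCLM_eq_iff (by fun_prop) _ _).1 hg⟩

end Fourier

/-! ### The resolvent of a self-adjoint operator on the imaginary axis -/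

section Resolvent

variable {E : Type*} [NormedAddCommGroup E] [InnerProductSpace ℂ E] [CompleteSpace E]

theorem isUnit_one_add_I_smul {A : E →L[ℂ] E} (hA : IsSelfAdjoint A) (t : ℝ) :
    IsUnit (1 + (t * Complex.I : ℂ) • A) := by
  rcases eq_or_ne t 0 with rfl | ht
  · simp
  have hz : (Complex.I / t : ℂ) ∉ spectrum ℂ A := by
    intro hmem
    have := congrArg Complex.im (hA.mem_spectrum_eq_re hmem)
    simp [Complex.div_im, ht] at this
  rw [spectrum.notMem_iff] at hz
  have hne : (-(t * Complex.I) : ℂ) ≠ 0 := by simp [ht]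
  have h2 : (1 + (t * Complex.I : ℂ) • A) =
      (-(t * Complex.I) : ℂ) • ((algebraMap ℂ (E →L[ℂ] E)) (Complex.I / t) - A) := by
    have h3 : (-(t * Complex.I) * (Complex.I / t) : ℂ) = 1 := by
      have : (t : ℂ) ≠ 0 := by exact_mod_cast ht
      field_simp
      simp
    rw [smul_sub, Algebra.algebraMap_eq_smul_one, smul_smul, h3, neg_smul, sub_neg_eq_add, one_smul]
  rw [h2]
  exact (isUnit_smul_iff (Units.mk0 _ hne) _).2 hz

theorem continuous_inverse_one_add_I_smul {A : E →L[ℂ] E} (hA : IsSelfAdjoint A) :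
    Continuous fun t : ℝ ↦ Ring.inverse (1 + (t * Complex.I : ℂ) • A) := by
  rw [continuous_iff_continuousAt]
  intro t
  obtain ⟨v, hv⟩ := isUnit_one_add_I_smul hA t
  have h1 := NormedRing.inverse_continuousAt v
  rw [hv] at h1
  exact ContinuousAt.comp (f := fun t : ℝ ↦ (1 + (t * Complex.I : ℂ) • A)) h1 (by fun_prop)

end Resolvent

/-! ### Primitives on an interval -/

section Primitive

/-- The primitive `y ↦ ∫_{z < y} u dμ` of `u`. For `μ` Lebesgue measure on `(0,M)` it vanishes at
`0` and is defined on all of `ℝ`, which saves restricting to `[0,M]`. -/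
def prim (μ : Measure ℝ) (u : ℝ → ℂ) (y : ℝ) : ℂ := ∫ z in Iio y, u z ∂μ

variable {μ : Measure ℝ} {u v : ℝ → ℂ}

theorem prim_congr (h : u =ᵐ[μ] v) : prim μ u = prim μ v := by
  ext y
  exact integral_congr_ae (ae_restrict_of_ae h)

theorem norm_prim_le (hu : Integrable u μ) (y : ℝ) : ‖prim μ u y‖ ≤ ∫ z, ‖u z‖ ∂μ :=
  (norm_integral_le_integral_norm _).trans
    (setIntegral_le_integral hu.norm (Filter.Eventually.of_forall fun _ ↦ norm_nonneg _))

theorem prim_add (hu : Integrable u μ) (hv : Integrable v μ) :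
    prim μ (u + v) = prim μ u + prim μ v := by
  ext y
  exact integral_add hu.integrableOn hv.integrableOn

theorem prim_sub (hu : Integrable u μ) (hv : Integrable v μ) :
    prim μ (u - v) = prim μ u - prim μ v := by
  ext y
  exact integral_sub hu.integrableOn hv.integrableOn

theorem prim_const_smul (c : ℂ) (u : ℝ → ℂ) : prim μ (c • u) = c • prim μ u := by
  ext y
  exact integral_smul c _

theorem prim_conj (u : ℝ → ℂ) (y : ℝ) :
    prim μ (fun z ↦ starRingEnd ℂ (u z)) y = starRingEnd ℂ (prim μ u y) :=
  integral_conj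

theorem continuous_prim [NullSingletonClass μ] (hu : Integrable u μ) : Continuous (prim μ u) := by
  have h (y : ℝ) : prim μ u y = (∫ z in Iic 0, u z ∂μ) + ∫ z in (0 : ℝ)..y, u z ∂μ := by
    rw [← intervalIntegral.integral_Iic_sub_Iic hu.integrableOn hu.integrableOn, prim,
      integral_Iic_eq_integral_Iio (x := y)]
    ring
  rw [funext h]
  exact continuous_const.add (hu.continuous_primitive 0)

theorem integrable_mul_prim [NullSingletonClass μ] [SFinite μ]
    (hu : Integrable u μ) (hv : Integrable v μ) :
    Integrable (fun y ↦ u y * prim μ v y) μ :=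
  hu.mul_bdd (c := ∫ z, ‖v z‖ ∂μ) (continuous_prim hv).aestronglyMeasurable
    (Filter.Eventually.of_forall (norm_prim_le hv))

/-- Integration by parts for primitives: Fubini's theorem on the square, cut along its
diagonal. -/
theorem integral_prim_mul_add [NullSingletonClass μ] [SFinite μ]
    (hu : Integrable u μ) (hv : Integrable v μ) :
    ∫ y, prim μ u y * v y ∂μ + ∫ y, u y * prim μ v y ∂μ = (∫ y, u y ∂μ) * ∫ y, v y ∂μ := by
  set f : ℝ → ℝ → ℂ := fun y z ↦ (Iio y).indicator u z * v y with hf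
  have hprod : Integrable (fun p : ℝ × ℝ ↦ u p.2 * v p.1) (μ.prod μ) := by
    simpa [mul_comm] using hv.mul_prod hu
  have hfi : Integrable (Function.uncurry f) (μ.prod μ) := by
    have hs : MeasurableSet {p : ℝ × ℝ | p.2 < p.1} :=
      measurableSet_lt measurable_snd measurable_fst
    refine (hprod.indicator hs).congr (Filter.Eventually.of_forall fun p ↦ ?_)
    by_cases h : p.2 < p.1 <;> simp [f, Function.uncurry, h]
  have h1 : ∫ y, prim μ u y * v y ∂μ = ∫ y, ∫ z, f y z ∂μ ∂μ := by
    refine integral_congr_ae (Filter.Eventually.of_forall fun y ↦ ?_)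
    simp only [hf, prim]
    rw [integral_mul_const, integral_indicator measurableSet_Iio]
  have h2 : ∀ z, ∫ y, f y z ∂μ = u z * ((∫ y, v y ∂μ) - prim μ v z) := by
    intro z
    have e : ∀ y, f y z = u z * (Ioi z).indicator v y := by
      intro y
      by_cases h : z < y <;> simp [f, h]
    simp only [e]
    rw [integral_const_mul, integral_indicator measurableSet_Ioi]
    congr 1
    rw [prim, ← integral_Iic_eq_integral_Iio, ← compl_Iic, setIntegral_compl measurableSet_Iic hv]
  rw [h1, integral_integral_swap hfi]
  simp only [h2, mul_sub]
  rw [integral_sub (hu.mul_const _) (integrable_mul_prim hu hv), integral_mul_const]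
  ring

end Primitive

section Strip

variable {M : ℝ}

/-- Lebesgue measure on `(0,M)`. -/
abbrev volIoo (M : ℝ) : Measure ℝ := volume.restrict (Ioo (0 : ℝ) M)

theorem L2y.integrable (u : L2y M) : Integrable u (volIoo M) :=
  (Lp.memLp u).integrable (by norm_num)

theorem prim_zero (u : ℝ → ℂ) : prim (volIoo M) u 0 = 0 := by
  rw [prim, Measure.restrict_restrict measurableSet_Iio]
  have : Iio (0 : ℝ) ∩ Ioo 0 M = ∅ := by
    ext z
    simp only [mem_inter_iff, mem_Iio, mem_Ioo, mem_empty_iff_false, iff_false]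
    rintro ⟨h1, h2, -⟩
    linarith
  simp [this]

theorem prim_right (u : ℝ → ℂ) : prim (volIoo M) u M = ∫ y, u y ∂(volIoo M) := by
  rw [prim, Measure.restrict_restrict measurableSet_Iio]
  congr 2
  exact inter_eq_right.2 fun z hz ↦ hz.2

theorem prim_eq_intervalIntegral (u : ℝ → ℂ) {y : ℝ} (hy : y ∈ Icc 0 M) :
    prim (volIoo M) u y = ∫ z in (0 : ℝ)..y, u z := by
  rw [prim, Measure.restrict_restrict measurableSet_Iio, intervalIntegral.integral_of_le hy.1,
    integral_Ioc_eq_integral_Ioo]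
  congr 2
  ext z
  simp only [mem_inter_iff, mem_Iio, mem_Ioo]
  constructor
  · rintro ⟨h1, h2, h3⟩
    exact ⟨h2, h1⟩
  · rintro ⟨h1, h2⟩
    exact ⟨h2, h1, h2.trans_le hy.2⟩

/-- The product rule `(y P)' = P + y u` for the primitive `P` of `u`, in integrated form. -/
theorem mul_prim_eq {u : ℝ → ℂ} (hu : Integrable u (volIoo M)) {y : ℝ} (hy : y ∈ Icc 0 M) :
    (y : ℂ) * prim (volIoo M) u y =
      prim (volIoo M) (fun z ↦ prim (volIoo M) u z + (z : ℂ) * u z) y := by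
  -- Integration by parts on `(0,y)` against the constant function `1`, whose primitive is `z`.
  set ν := (volIoo M).restrict (Iio y) with hν
  have hle : ∀ (w : ℝ → ℂ) (z : ℝ), z ≤ y → prim ν w z = prim (volIoo M) w z := by
    intro w z hz
    rw [prim, prim, hν, Measure.restrict_restrict measurableSet_Iio,
      inter_eq_left.2 (Iio_subset_Iio hz)]
  have huν : Integrable u ν := hu.restrict
  have h1ν : Integrable (fun _ : ℝ ↦ (1 : ℂ)) ν := integrable_const _
  have key := integral_prim_mul_add huν h1ν
  have hae : ∀ᵐ z ∂ν, z < y ∧ 0 < z ∧ z < M := by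
    filter_upwards [ae_restrict_mem measurableSet_Iio,
      ae_restrict_of_ae (ae_restrict_mem measurableSet_Ioo)] with z h1 h2
    exact ⟨h1, h2.1, h2.2⟩
  have hone : ∀ z ∈ Icc 0 M, prim (volIoo M) (fun _ ↦ (1 : ℂ)) z = z := by
    intro z hz
    rw [prim_eq_intervalIntegral _ hz]
    simp
  have e1 : ∫ z, prim ν u z * 1 ∂ν = ∫ z, prim (volIoo M) u z ∂ν := by
    refine integral_congr_ae ?_
    filter_upwards [hae] with z hz
    rw [mul_one, hle u z hz.1.le]
  have e2 : ∫ z, u z * prim ν (fun _ ↦ 1) z ∂ν = ∫ z, (z : ℂ) * u z ∂ν := by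
    refine integral_congr_ae ?_
    filter_upwards [hae] with z hz
    rw [hle _ z hz.1.le, hone z ⟨hz.2.1.le, hz.2.2.le⟩, mul_comm]
  have e3 : ∫ _, (1 : ℂ) ∂ν = y := hone y hy
  have i1 : Integrable (fun z ↦ prim (volIoo M) u z) ν :=
    (Integrable.of_bound (continuous_prim hu).aestronglyMeasurable (∫ z, ‖u z‖ ∂(volIoo M))
      (Filter.Eventually.of_forall (norm_prim_le hu))).restrict
  have i2 : Integrable (fun z : ℝ ↦ (z : ℂ) * u z) ν := by
    refine huν.bdd_mul (c := M) (by fun_prop) ?_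
    filter_upwards [hae] with z hz
    rw [Complex.norm_real, Real.norm_eq_abs, abs_of_pos hz.2.1]
    exact hz.2.2.le
  rw [e1, e2, e3] at key
  rw [mul_comm]
  change (∫ z, u z ∂ν) * (y : ℂ) = ∫ z, (prim (volIoo M) u z + (z : ℂ) * u z) ∂ν
  rw [integral_add i1 i2, key]

theorem integral_norm_le (u : L2y M) :
    ∫ y, ‖u y‖ ∂(volIoo M) ≤ √|M| * ‖u‖ := by
  have h1 := eLpNorm_le_eLpNorm_mul_rpow_measure_univ (μ := volIoo M) (p := 1) (q := 2)
    (by norm_num) (Lp.aestronglyMeasurable u)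
  have h2 : ∫ y, ‖u y‖ ∂(volIoo M) = (eLpNorm u 1 (volIoo M)).toReal := by
    rw [eLpNorm_one_eq_lintegral_enorm,
      integral_norm_eq_lintegral_enorm (Lp.aestronglyMeasurable u)]
  have h3 : (volIoo M) univ = ENNReal.ofReal M := by simp
  rw [h2, Lp.norm_def]
  refine (ENNReal.toReal_mono ?_ h1).trans ?_
  · refine ENNReal.mul_ne_top (Lp.eLpNorm_ne_top u) ?_
    rw [h3]
    exact ENNReal.rpow_ne_top_of_nonneg (by norm_num) ENNReal.ofReal_ne_top
  · rw [ENNReal.toReal_mul, mul_comm, h3, ← ENNReal.toReal_rpow, ENNReal.toReal_ofReal']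
    refine mul_le_mul_of_nonneg_right ?_ ENNReal.toReal_nonneg
    rw [Real.sqrt_eq_rpow]
    norm_num
    exact Real.rpow_le_rpow (by positivity) (max_le (le_abs_self M) (abs_nonneg M)) (by norm_num)

theorem norm_le_of_bound {v : L2y M} {C : ℝ} (hC : 0 ≤ C) (h : ∀ᵐ y ∂(volIoo M), ‖v y‖ ≤ C) :
    ‖v‖ ≤ √|M| * C := by
  refine (Lp.norm_le_of_ae_bound hC h).trans (mul_le_mul_of_nonneg_right ?_ hC)
  have h3 : (volIoo M) univ = ENNReal.ofReal M := by simp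
  rw [Real.sqrt_eq_rpow]
  rw [measureUnivNNReal, h3]
  norm_num
  exact Real.rpow_le_rpow (by positivity) (max_le (le_abs_self M) (abs_nonneg M)) (by norm_num)

theorem memLp_prim (u : L2y M) : MemLp (prim (volIoo M) u) 2 (volIoo M) :=
  MemLp.of_bound (continuous_prim u.integrable).aestronglyMeasurable (∫ z, ‖u z‖ ∂(volIoo M))
    (Filter.Eventually.of_forall (norm_prim_le u.integrable))

/-- The operator `u ↦ ∫_0^y u` on `L²(0,M)`. -/
def primL (M : ℝ) : L2y M →L[ℂ] L2y M :=
  LinearMap.mkContinuous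
    { toFun := fun u ↦ (memLp_prim u).toLp
      map_add' := fun u v ↦ by
        rw [← MemLp.toLp_add]
        refine MemLp.toLp_congr _ _ (Filter.Eventually.of_forall fun y ↦ ?_)
        rw [prim_congr (Lp.coeFn_add u v), prim_add u.integrable v.integrable]
      map_smul' := fun c u ↦ by
        rw [RingHom.id_apply, ← MemLp.toLp_const_smul]
        refine MemLp.toLp_congr _ _ (Filter.Eventually.of_forall fun y ↦ ?_)
        rw [prim_congr (Lp.coeFn_smul c u), prim_const_smul] }
    |M| fun u ↦ by
      have h : ∀ᵐ y ∂(volIoo M), ‖(memLp_prim u).toLp _ y‖ ≤ √|M| * ‖u‖ := by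
        filter_upwards [(memLp_prim u).coeFn_toLp] with y hy
        rw [hy]
        exact (norm_prim_le u.integrable y).trans (integral_norm_le u)
      refine (norm_le_of_bound (by positivity) h).trans_eq ?_
      rw [← mul_assoc, Real.mul_self_sqrt (abs_nonneg M)]

theorem coeFn_primL (u : L2y M) : primL M u =ᵐ[volIoo M] prim (volIoo M) u :=
  (memLp_prim u).coeFn_toLp

theorem norm_primL_le : ‖primL M‖ ≤ |M| :=
  LinearMap.mkContinuous_norm_le _ (abs_nonneg M) _

/-- The operator `u ↦ -∫_y^M u` on `L²(0,M)`, defined as the negative adjoint of `u ↦ ∫_0^y u`;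
the integral formula is `coeFn_primR`. -/
def primR (M : ℝ) : L2y M →L[ℂ] L2y M := -(ContinuousLinearMap.adjoint (primL M))

theorem norm_primR_le : ‖primR M‖ ≤ |M| := by
  rw [primR, norm_neg, LinearIsometryEquiv.norm_map]
  exact norm_primL_le

theorem inner_primR_left (u v : L2y M) : inner ℂ (primR M u) v = -inner ℂ u (primL M v) := by
  rw [primR, neg_apply, inner_neg_left,
    ContinuousLinearMap.adjoint_inner_left]

/-- `K u (y) = ∫_0^y u - ∫_0^M u = -∫_y^M u`, by integration by parts. -/
theorem coeFn_primR (u : L2y M) :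
    primR M u =ᵐ[volIoo M] fun y ↦ prim (volIoo M) u y - ∫ z, u z ∂(volIoo M) := by
  have hc : MemLp (fun _ : ℝ ↦ ∫ z, u z ∂(volIoo M)) 2 (volIoo M) := memLp_const _
  have hm : MemLp (fun y ↦ prim (volIoo M) u y - ∫ z, u z ∂(volIoo M)) 2 (volIoo M) :=
    (memLp_prim u).sub hc
  suffices h : primR M u = hm.toLp by
    rw [h]
    exact hm.coeFn_toLp
  refine ext_inner_right ℂ fun v ↦ ?_
  rw [inner_primR_left, L2.inner_def, L2.inner_def]
  have e1 : ∫ y, inner ℂ (u y) (primL M v y) ∂(volIoo M) =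
      ∫ y, (starRingEnd ℂ (u y)) * prim (volIoo M) v y ∂(volIoo M) := by
    refine integral_congr_ae ?_
    filter_upwards [coeFn_primL v] with y hy
    rw [hy, RCLike.inner_apply, mul_comm]
  have e2 : ∫ y, inner ℂ (hm.toLp _ y) (v y) ∂(volIoo M) =
      ∫ y, (prim (volIoo M) (fun z ↦ starRingEnd ℂ (u z)) y * v y -
        (∫ z, starRingEnd ℂ (u z) ∂(volIoo M)) * v y) ∂(volIoo M) := by
    refine integral_congr_ae ?_
    filter_upwards [hm.coeFn_toLp] with y hy
    rw [hy, RCLike.inner_apply, prim_conj, integral_conj, map_sub]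
    ring
  have hu' : Integrable (fun z ↦ starRingEnd ℂ (u z)) (volIoo M) :=
    Complex.conjCLE.toContinuousLinearMap.integrable_comp u.integrable
  have hi : Integrable (fun y ↦ prim (volIoo M) (fun z ↦ starRingEnd ℂ (u z)) y * v y)
      (volIoo M) := by
    simpa only [mul_comm] using integrable_mul_prim v.integrable hu'
  rw [e1, e2, integral_sub hi (v.integrable.const_mul _), integral_const_mul,
    ← integral_prim_mul_add hu' v.integrable]
  ring

end Strip

/-! ### Powers of `y` as operators, and their commutation with primitives -/

section Weights

variable {M : ℝ}

theorem ae_volIoo_mem : ∀ᵐ y ∂(volIoo M), y ∈ Ioo 0 M := ae_restrict_mem measurableSet_Ioo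

theorem norm_rpow_le_of_mem {y : ℝ} (k : ℝ≥0) (hy : y ∈ Ioo 0 M) :
    ‖((y ^ (k : ℝ) : ℝ) : ℂ)‖ ≤ |M| ^ (k : ℝ) := by
  rw [Complex.norm_real, Real.norm_eq_abs, abs_of_nonneg (Real.rpow_nonneg hy.1.le _)]
  exact Real.rpow_le_rpow hy.1.le (hy.2.le.trans (le_abs_self M)) k.2

theorem memLp_rpow_mul (k : ℝ≥0) (u : L2y M) :
    MemLp (fun y ↦ ((y ^ (k : ℝ) : ℝ) : ℂ) * u y) 2 (volIoo M) := by
  refine MemLp.of_le_mul (c := |M| ^ (k : ℝ)) (Lp.memLp u) ?_ ?_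
  · refine AEStronglyMeasurable.mul ?_ (Lp.aestronglyMeasurable u)
    exact (Complex.measurable_ofReal.comp (by fun_prop)).aestronglyMeasurable
  · filter_upwards [ae_volIoo_mem] with y hy
    rw [norm_mul]
    exact mul_le_mul_of_nonneg_right (norm_rpow_le_of_mem k hy) (norm_nonneg _)

/-- Multiplication by `y ^ k` on `L²(0,M)`. The exponent is nonnegative, so that the factor is
bounded. -/
def weight (M : ℝ) (k : ℝ≥0) : L2y M →L[ℂ] L2y M :=
  LinearMap.mkContinuous
    { toFun := fun u ↦ (memLp_rpow_mul k u).toLp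
      map_add' := fun u v ↦ by
        rw [← MemLp.toLp_add]
        refine MemLp.toLp_congr _ _ ?_
        filter_upwards [Lp.coeFn_add u v] with y hy
        simp only [hy, Pi.add_apply]
        ring
      map_smul' := fun c u ↦ by
        rw [RingHom.id_apply, ← MemLp.toLp_const_smul]
        refine MemLp.toLp_congr _ _ ?_
        filter_upwards [Lp.coeFn_smul c u] with y hy
        simp only [hy, Pi.smul_apply, smul_eq_mul]
        ring }
    (|M| ^ (k : ℝ)) fun u ↦ by
      refine Lp.norm_le_mul_norm_of_ae_le_mul ?_
      filter_upwards [ae_volIoo_mem, (memLp_rpow_mul k u).coeFn_toLp] with y hy hy2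
      rw [LinearMap.coe_mk, AddHom.coe_mk, hy2, norm_mul]
      exact mul_le_mul_of_nonneg_right (norm_rpow_le_of_mem k hy) (norm_nonneg _)

theorem coeFn_weight (k : ℝ≥0) (u : L2y M) :
    weight M k u =ᵐ[volIoo M] fun y ↦ ((y ^ (k : ℝ) : ℝ) : ℂ) * u y :=
  (memLp_rpow_mul k u).coeFn_toLp

theorem coeFn_weight_one (u : L2y M) :
    weight M 1 u =ᵐ[volIoo M] fun y ↦ (y : ℂ) * u y := by
  filter_upwards [coeFn_weight 1 u] with y hy
  rw [hy, NNReal.coe_one, Real.rpow_one]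

theorem norm_weight_le (k : ℝ≥0) : ‖weight M k‖ ≤ |M| ^ (k : ℝ) :=
  LinearMap.mkContinuous_norm_le _ (by positivity) _

theorem weight_zero : weight M 0 = ContinuousLinearMap.id ℂ (L2y M) := by
  ext1 u
  refine Lp.ext ?_
  filter_upwards [coeFn_weight 0 u] with y hy
  simpa using hy

theorem inner_weight_add (k l : ℝ≥0) (u v : L2y M) :
    inner ℂ (weight M k u) (weight M l v) = inner ℂ u (weight M (k + l) v) := by
  rw [L2.inner_def, L2.inner_def]
  refine integral_congr_ae ?_
  filter_upwards [coeFn_weight k u, coeFn_weight l v, coeFn_weight (k + l) v, ae_volIoo_mem]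
    with y h1 h2 h3 hy
  rw [h1, h2, h3, NNReal.coe_add, Real.rpow_add hy.1]
  simp only [RCLike.inner_apply, map_mul, Complex.conj_ofReal, Complex.ofReal_mul]
  ring

theorem isSelfAdjoint_weight (k : ℝ≥0) : IsSelfAdjoint (weight M k) := by
  rw [ContinuousLinearMap.isSelfAdjoint_iff_isSymmetric]
  intro u v
  have h := inner_weight_add k 0 u v
  simp only [weight_zero, ContinuousLinearMap.id_apply, add_zero] at h
  exact h

theorem prim_const (c : ℂ) {y : ℝ} (hy : y ∈ Icc 0 M) : prim (volIoo M) (fun _ ↦ c) y = y * c := by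
  rw [prim_eq_intervalIntegral _ hy]
  simp

theorem prim_primR_add_weight (u : L2y M) {y : ℝ} (hy : y ∈ Icc 0 M) :
    prim (volIoo M) (primR M u + weight M 1 u : L2y M) y =
      y * (prim (volIoo M) u y - ∫ z, u z ∂(volIoo M)) := by
  set c := ∫ z, u z ∂(volIoo M)
  have hw : (primR M u + weight M 1 u : L2y M) =ᵐ[volIoo M]
      (fun z : ℝ ↦ prim (volIoo M) u z + (z : ℂ) * u z) - fun _ ↦ c := by
    filter_upwards [Lp.coeFn_add (primR M u) (weight M 1 u), coeFn_primR u, coeFn_weight_one u]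
      with z h1 h2 h3
    rw [h1, Pi.add_apply, h2, h3, Pi.sub_apply]
    ring
  have hi : Integrable (fun z : ℝ ↦ prim (volIoo M) u z + (z : ℂ) * u z) (volIoo M) := by
    refine (((primR M u + weight M 1 u : L2y M).integrable.congr hw).add
      (integrable_const c)).congr (Filter.Eventually.of_forall fun z ↦ ?_)
    simp
  rw [prim_congr hw, prim_sub hi (integrable_const c), Pi.sub_apply, prim_const c hy,
    ← mul_prim_eq u.integrable hy]
  ring

theorem weight_primR_eq_primL (u : L2y M) :
    weight M 1 (primR M u) = primL M (primR M u + weight M 1 u) := by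
  refine Lp.ext ?_
  filter_upwards [coeFn_weight_one (primR M u), coeFn_primR u,
    coeFn_primL (primR M u + weight M 1 u), ae_volIoo_mem] with y h1 h2 h3 hy
  rw [h1, h2, h3, prim_primR_add_weight u (Ioo_subset_Icc_self hy)]

theorem weight_primR_eq_primR (u : L2y M) :
    weight M 1 (primR M u) = primR M (primR M u + weight M 1 u) := by
  rw [weight_primR_eq_primL]
  refine Lp.ext ?_
  filter_upwards [coeFn_primL (primR M u + weight M 1 u),
    coeFn_primR (primR M u + weight M 1 u), ae_volIoo_mem] with y h1 h2 hy
  have hM : 0 ≤ M := hy.1.le.trans hy.2.le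
  rw [h1, h2, ← prim_right, prim_primR_add_weight u (right_mem_Icc.2 hM), prim_right]
  simp

end Weights

/-! ### Weak derivatives and traces -/

section WeakDerivatives

variable {M : ℝ}

theorem prim_deriv_of_tsupport_subset {φ : ℝ → ℂ} (hφ : ContDiff ℝ ∞ φ)
    (hs : tsupport φ ⊆ Ioo 0 M) {y : ℝ} (hy : y ∈ Icc 0 M) :
    prim (volIoo M) (deriv φ) y = φ y := by
  have h0 : φ 0 = 0 := image_eq_zero_of_notMem_tsupport fun h ↦ lt_irrefl _ (hs h).1
  rw [prim_eq_intervalIntegral _ hy, intervalIntegral.integral_deriv_eq_sub, h0, sub_zero]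
  · exact fun x _ ↦ (hφ.differentiable (by simp)).differentiableAt
  · exact (hφ.continuous_deriv (by simp)).intervalIntegrable _ _

theorem integrable_of_continuous {f : ℝ → ℂ} (hf : Continuous f) : Integrable f (volIoo M) :=
  (hf.continuousOn.integrableOn_compact isCompact_Icc).mono_set Ioo_subset_Icc_self

theorem integrable_mul_L2y {f : ℝ → ℂ} (hf : Continuous f) (u : L2y M) :
    Integrable (fun y ↦ f y * u y) (volIoo M) := by
  obtain ⟨C, hC⟩ := isCompact_Icc.exists_bound_of_continuousOn (hf.continuousOn (s := Icc 0 M))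
  refine u.integrable.bdd_mul (c := C) hf.aestronglyMeasurable ?_
  filter_upwards [ae_volIoo_mem] with y hy
  exact hC y (Ioo_subset_Icc_self hy)

theorem hasWeakDeriv_one_of_ae_eq (hM : 0 ≤ M) {u v : L2y M} {c : ℂ}
    (h : u =ᵐ[volIoo M] fun y ↦ prim (volIoo M) v y + c) : HasWeakDeriv M 1 u v := by
  intro φ hφ _ hs
  have hφ' : Continuous (deriv φ) := hφ.continuous_deriv (by simp)
  have hM' : φ M = 0 := image_eq_zero_of_notMem_tsupport fun h ↦ lt_irrefl _ (hs h).2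
  have hint : ∫ y, deriv φ y ∂(volIoo M) = 0 := by
    rw [← prim_right, prim_deriv_of_tsupport_subset hφ hs (right_mem_Icc.2 hM), hM']
  have key := integral_prim_mul_add (integrable_of_continuous (M := M) hφ') v.integrable
  rw [hint, zero_mul] at key
  have e1 : ∫ y, iteratedDeriv 1 φ y * u y ∂(volIoo M) =
      ∫ y, (deriv φ y * prim (volIoo M) v y + deriv φ y * c) ∂(volIoo M) := by
    refine integral_congr_ae ?_
    filter_upwards [h] with y hy
    rw [hy, iteratedDeriv_one]
    ring
  have e2 : ∫ y, φ y * v y ∂(volIoo M) =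
      ∫ y, prim (volIoo M) (deriv φ) y * v y ∂(volIoo M) := by
    refine integral_congr_ae ?_
    filter_upwards [ae_volIoo_mem] with y hy
    rw [prim_deriv_of_tsupport_subset hφ hs (Ioo_subset_Icc_self hy)]
  rw [e1, e2, integral_add (integrable_mul_prim (integrable_of_continuous hφ') v.integrable)
    ((integrable_of_continuous hφ').mul_const c), integral_mul_const, hint]
  linear_combination key

theorem hasWeakDeriv_primL (hM : 0 ≤ M) (v : L2y M) : HasWeakDeriv M 1 (primL M v) v :=
  hasWeakDeriv_one_of_ae_eq (c := 0) hM (by simpa using coeFn_primL v)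

theorem hasWeakDeriv_primR (hM : 0 ≤ M) (v : L2y M) : HasWeakDeriv M 1 (primR M v) v :=
  hasWeakDeriv_one_of_ae_eq (c := -∫ z, v z ∂(volIoo M)) hM
    (by simpa only [sub_eq_add_neg] using coeFn_primR v)

theorem isTest_deriv {φ : ℝ → ℂ} (hφ : ContDiff ℝ ∞ φ) (hc : HasCompactSupport φ)
    (hs : tsupport φ ⊆ Ioo 0 M) :
    ContDiff ℝ ∞ (deriv φ) ∧ HasCompactSupport (deriv φ) ∧ tsupport (deriv φ) ⊆ Ioo 0 M :=
  ⟨((contDiff_infty_iff_deriv).1 hφ).2, hc.deriv, tsupport_deriv_subset.trans hs⟩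

theorem iteratedDeriv_one_deriv (φ : ℝ → ℂ) : iteratedDeriv 1 (deriv φ) = iteratedDeriv 2 φ := by
  rw [iteratedDeriv_succ' (n := 1)]

theorem HasWeakDeriv.two_of_one {u v w : L2y M} (huv : HasWeakDeriv M 1 u v)
    (hvw : HasWeakDeriv M 1 v w) : HasWeakDeriv M 2 u w := by
  intro φ hφ hc hs
  obtain ⟨h1, h2, h3⟩ := isTest_deriv hφ hc hs
  have e1 := huv _ h1 h2 h3
  have e2 := hvw _ hφ hc hs
  rw [iteratedDeriv_one_deriv] at e1
  rw [iteratedDeriv_one] at e2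
  rw [e1, e2]
  ring

theorem HasWeakDeriv.one_of_two {u v w : L2y M} (huv : HasWeakDeriv M 1 u v)
    (huw : HasWeakDeriv M 2 u w) : HasWeakDeriv M 1 v w := by
  intro φ hφ hc hs
  obtain ⟨h1, h2, h3⟩ := isTest_deriv hφ hc hs
  have e1 := huv _ h1 h2 h3
  have e2 := huw _ hφ hc hs
  rw [iteratedDeriv_one_deriv] at e1
  rw [iteratedDeriv_one]
  linear_combination e1 - e2

/-- A test function on `(0,M)` with vanishing integral is the derivative of a test function. -/
theorem exists_primitive_of_integral_eq_zero (hM : 0 < M) {χ : ℝ → ℝ} (hχ : ContDiff ℝ ∞ χ)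
    (hs : tsupport χ ⊆ Ioo 0 M) (hc : HasCompactSupport χ) (h0 : ∫ y in (0 : ℝ)..M, χ y = 0) :
    ∃ Φ : ℝ → ℝ, ContDiff ℝ ∞ Φ ∧ HasCompactSupport Φ ∧ tsupport Φ ⊆ Ioo 0 M ∧ deriv Φ = χ := by
  -- Inserting `M / 2` makes the compact set nonempty, so that it has a least and a greatest point.
  have hK : IsCompact (insert (M / 2) (tsupport χ)) := IsCompact.insert hc _
  have hsub : insert (M / 2) (tsupport χ) ⊆ Ioo 0 M :=
    insert_subset ⟨by linarith, by linarith⟩ hs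
  obtain ⟨a, ha, hamin⟩ := hK.exists_isLeast (insert_nonempty _ _)
  obtain ⟨b, hb, hbmax⟩ := hK.exists_isGreatest (insert_nonempty _ _)
  have hχ0 : ∀ y, y ∉ Icc a b → χ y = 0 := fun y hy ↦
    image_eq_zero_of_notMem_tsupport fun h ↦
      hy ⟨hamin (mem_insert_of_mem _ h), hbmax (mem_insert_of_mem _ h)⟩
  have hd : ∀ y, HasDerivAt (fun t ↦ ∫ z in (0 : ℝ)..t, χ z) (χ y) y := fun y ↦
    intervalIntegral.integral_hasDerivAt_right (hχ.continuous.intervalIntegrable _ _)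
      (hχ.continuous.stronglyMeasurableAtFilter _ _) hχ.continuous.continuousAt
  have hderiv : deriv (fun t ↦ ∫ z in (0 : ℝ)..t, χ z) = χ := funext fun y ↦ (hd y).deriv
  have hsupp : Function.support (fun t ↦ ∫ z in (0 : ℝ)..t, χ z) ⊆ Icc a b := by
    intro y hy
    by_contra hyn
    refine hy ?_
    rcases lt_or_ge y a with h | h
    · refine intervalIntegral.integral_zero_ae (Filter.Eventually.of_forall fun z hz ↦ ?_)
      refine hχ0 z fun hz' ↦ ?_
      rw [mem_uIoc] at hz
      have := (hsub ha).1
      rcases hz with hz | hz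
      · linarith [hz'.1, hz.2]
      · linarith [hz'.1, hz.2]
    · have h' : b < y := by
        by_contra h2
        exact hyn ⟨h, not_lt.1 h2⟩
      have e : ∫ z in (0 : ℝ)..y, χ z = (∫ z in (0 : ℝ)..M, χ z) + ∫ z in M..y, χ z :=
        (intervalIntegral.integral_add_adjacent_intervals
          (hχ.continuous.intervalIntegrable _ _) (hχ.continuous.intervalIntegrable _ _)).symm
      change ∫ z in (0 : ℝ)..y, χ z = 0
      rw [e, h0, zero_add]
      refine intervalIntegral.integral_zero_ae (Filter.Eventually.of_forall fun z hz ↦ ?_)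
      refine hχ0 z fun hz' ↦ ?_
      rw [mem_uIoc] at hz
      have := (hsub hb).2
      rcases hz with hz | hz
      · linarith [hz'.2, hz.1]
      · linarith [hz'.2, hz.1]
  have ht : tsupport (fun t ↦ ∫ z in (0 : ℝ)..t, χ z) ⊆ Icc a b :=
    closure_minimal hsupp isClosed_Icc
  refine ⟨_, ?_, HasCompactSupport.of_support_subset_isCompact isCompact_Icc hsupp,
    ht.trans (Icc_subset_Ioo (hsub ha).1 (hsub hb).2), hderiv⟩
  rw [contDiff_infty_iff_deriv, hderiv]
  exact ⟨fun y ↦ (hd y).differentiableAt, hχ⟩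

theorem integral_mul_coeFn_zero (f : ℝ → ℂ) : ∫ y, f y * (0 : L2y M) y ∂(volIoo M) = 0 := by
  rw [← integral_zero ℝ ℂ (μ := volIoo M)]
  refine integral_congr_ae ?_
  filter_upwards [Lp.coeFn_zero ℂ 2 (volIoo M)] with y hy
  rw [hy, Pi.zero_apply, mul_zero]

/-- The du Bois-Reymond lemma: a function with vanishing weak derivative is constant. -/
theorem ae_eq_const_of_hasWeakDeriv_zero (hM : 0 < M) {w : L2y M} (hw : HasWeakDeriv M 1 w 0) :
    ∃ c : ℂ, ∀ᵐ y ∂(volIoo M), w y = c := by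
  let B : ContDiffBump (M / 2) := ⟨M / 8, M / 4, by linarith, by linarith⟩
  set θ : ℝ → ℝ := B.normed volume with hθ
  have hθd : ContDiff ℝ ∞ θ := B.contDiff_normed
  have hθc : HasCompactSupport θ := B.hasCompactSupport_normed
  have hθs : tsupport θ ⊆ Ioo 0 M := by
    rw [hθ, B.tsupport_normed_eq, Real.closedBall_eq_Icc]
    refine Icc_subset_Ioo ?_ ?_ <;> simp only [B] <;> linarith
  have hint : ∀ g : ℝ → ℝ, tsupport g ⊆ Ioo 0 M → ∫ y in (0 : ℝ)..M, g y = ∫ y, g y := by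
    intro g hg
    rw [intervalIntegral.integral_of_le hM.le, integral_Ioc_eq_integral_Ioo]
    exact setIntegral_eq_integral_of_forall_compl_eq_zero fun y hy ↦
      image_eq_zero_of_notMem_tsupport fun h ↦ hy (hg h)
  have hθ1 : ∫ y in (0 : ℝ)..M, θ y = 1 := by rw [hint θ hθs]; exact B.integral_normed
  set c := ∫ y, (θ y : ℂ) * w y ∂(volIoo M) with hc
  refine ⟨c, ?_⟩
  have hloc : LocallyIntegrableOn (fun y ↦ w y - c) (Ioo 0 M) :=
    IntegrableOn.locallyIntegrableOn (w.integrable.sub (integrable_const c))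
  have main := isOpen_Ioo.ae_eq_zero_of_integral_contDiff_smul_eq_zero hloc ?_
  · rw [ae_restrict_iff' measurableSet_Ioo]
    filter_upwards [main] with y hy hyM
    exact sub_eq_zero.1 (hy hyM)
  intro g hg hgc hgs
  -- `g - m θ` has integral zero, hence is the derivative of a test function.
  set m := ∫ y in (0 : ℝ)..M, g y with hm
  obtain ⟨Φ, h1, h2, h3, h4⟩ := exists_primitive_of_integral_eq_zero hM
    (χ := fun y ↦ g y - m * θ y) (by fun_prop)
    (by
      refine (tsupport_sub _ _).trans (union_subset hgs ?_)
      exact (tsupport_mul_subset_right (f := fun _ ↦ m)).trans hθs)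
    (hgc.sub hθc.mul_left)
    (by
      rw [intervalIntegral.integral_sub (hg.continuous.intervalIntegrable _ _)
        ((hθd.continuous.const_mul m).intervalIntegrable _ _), intervalIntegral.integral_const_mul,
        hθ1, hm]
      ring)
  have key := hw (fun y ↦ (Φ y : ℂ)) (Complex.ofRealCLM.contDiff.comp h1)
    (h2.comp_left Complex.ofReal_zero)
    ((tsupport_comp_subset Complex.ofReal_zero Φ).trans h3)
  have e0 : ∫ y, (Φ y : ℂ) * (0 : L2y M) y ∂(volIoo M) = 0 := integral_mul_coeFn_zero _
  have hd : ∀ y, iteratedDeriv 1 (fun y ↦ (Φ y : ℂ)) y = (g y : ℂ) - m * θ y := by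
    intro y
    have h5 : HasDerivAt Φ (g y - m * θ y) y := by
      have := (h1.differentiable (by simp) y).hasDerivAt
      rwa [h4] at this
    rw [iteratedDeriv_one, h5.ofReal_comp.deriv]
    push_cast
    ring
  rw [e0, mul_zero] at key
  simp only [hd, sub_mul, mul_assoc] at key
  have hgw : Integrable (fun y ↦ (g y : ℂ) * w y) (volIoo M) :=
    integrable_mul_L2y (Complex.continuous_ofReal.comp hg.continuous) w
  have hθw : Integrable (fun y ↦ (θ y : ℂ) * w y) (volIoo M) :=
    integrable_mul_L2y (Complex.continuous_ofReal.comp hθd.continuous) w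
  rw [integral_sub hgw (hθw.const_mul _), integral_const_mul, ← hc] at key
  rw [← setIntegral_eq_integral_of_forall_compl_eq_zero (s := Ioo 0 M)]
  · simp only [smul_sub, Complex.real_smul]
    have hgi : Integrable (fun y ↦ (g y : ℂ)) (volIoo M) :=
      integrable_of_continuous (Complex.continuous_ofReal.comp hg.continuous)
    have hgm : ∫ y, (g y : ℂ) ∂(volIoo M) = m := by
      rw [hm, intervalIntegral.integral_of_le hM.le, integral_Ioc_eq_integral_Ioo]
      exact integral_ofReal
    rw [integral_sub hgw (hgi.mul_const c), integral_mul_const, hgm]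
    exact key
  · intro y hy
    rw [image_eq_zero_of_notMem_tsupport fun h ↦ hy (hgs h), zero_smul]

theorem HasWeakDeriv.exists_ae_eq_prim_add (hM : 0 < M) {u v : L2y M} (h : HasWeakDeriv M 1 u v) :
    ∃ c : ℂ, u =ᵐ[volIoo M] fun y ↦ prim (volIoo M) v y + c := by
  have hw : HasWeakDeriv M 1 (u - primL M v) 0 := by
    intro φ hφ hc hs
    have h1 := h φ hφ hc hs
    have h2 := hasWeakDeriv_primL hM.le v φ hφ hc hs
    have hφ' : Continuous (iteratedDeriv 1 φ) := by
      rw [iteratedDeriv_one]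
      exact hφ.continuous_deriv (by simp)
    have e0 : ∫ y, φ y * (0 : L2y M) y ∂(volIoo M) = 0 := integral_mul_coeFn_zero _
    have e1 : ∫ y, iteratedDeriv 1 φ y * (u - primL M v : L2y M) y ∂(volIoo M) =
        ∫ y, (iteratedDeriv 1 φ y * u y - iteratedDeriv 1 φ y * primL M v y) ∂(volIoo M) := by
      refine integral_congr_ae ?_
      filter_upwards [Lp.coeFn_sub u (primL M v)] with y hy
      rw [hy, Pi.sub_apply, mul_sub]
    rw [e1, e0, integral_sub (integrable_mul_L2y hφ' u) (integrable_mul_L2y hφ' _), h1, h2]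
    ring
  obtain ⟨c, hc⟩ := ae_eq_const_of_hasWeakDeriv_zero hM hw
  refine ⟨c, ?_⟩
  filter_upwards [hc, Lp.coeFn_sub u (primL M v), coeFn_primL v] with y h1 h2 h3
  rw [h2, Pi.sub_apply, h3] at h1
  rw [← h1]
  ring

theorem HasTrace.eq_of_continuous (hM : 0 < M) {u : L2y M} {a : ℝ} (ha : a ∈ Icc 0 M) {c : ℂ}
    (h : HasTrace M u a c) {V : ℝ → ℂ} (hV : Continuous V) (huV : u =ᵐ[volIoo M] V) : V a = c := by
  obtain ⟨U, hU, huU, rfl⟩ := h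
  have h1 : U =ᵐ[volIoo M] V := (Filter.EventuallyEq.symm huU).trans huV
  have h2 : EqOn U V (Ioo 0 M) :=
    Measure.eqOn_open_of_ae_eq h1 isOpen_Ioo (hU.mono Ioo_subset_Icc_self) hV.continuousOn
  have h3 : EqOn U V (Icc 0 M) :=
    h2.of_subset_closure hU hV.continuousOn Ioo_subset_Icc_self (closure_Ioo hM.ne).ge
  exact (h3 ha).symm

theorem eq_primL_of_hasWeakDeriv (hM : 0 < M) {u v : L2y M} (h : HasWeakDeriv M 1 u v)
    (ht : HasTrace M u 0 0) : u = primL M v := by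
  obtain ⟨c, hc⟩ := h.exists_ae_eq_prim_add hM
  have h0 := ht.eq_of_continuous hM (left_mem_Icc.2 hM.le)
    ((continuous_prim v.integrable).add continuous_const) hc
  rw [Pi.add_apply, prim_zero, zero_add] at h0
  refine Lp.ext (hc.trans ?_)
  filter_upwards [coeFn_primL v] with y hy
  rw [hy, h0, add_zero]

theorem eq_primR_of_hasWeakDeriv (hM : 0 < M) {u v : L2y M} (h : HasWeakDeriv M 1 u v)
    (ht : HasTrace M u M 0) : u = primR M v := by
  obtain ⟨c, hc⟩ := h.exists_ae_eq_prim_add hM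
  have h0 := ht.eq_of_continuous hM (right_mem_Icc.2 hM.le)
    ((continuous_prim v.integrable).add continuous_const) hc
  rw [Pi.add_apply, prim_right] at h0
  refine Lp.ext (hc.trans ?_)
  filter_upwards [coeFn_primR v] with y hy
  rw [hy]
  linear_combination h0

theorem hasTrace_primL (v : L2y M) : HasTrace M (primL M v) 0 0 :=
  ⟨_, (continuous_prim v.integrable).continuousOn, coeFn_primL v, prim_zero _⟩

theorem hasTrace_primR (v : L2y M) : HasTrace M (primR M v) M 0 :=
  ⟨_, ((continuous_prim v.integrable).sub continuous_const).continuousOn, coeFn_primR v, by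
    rw [Pi.sub_apply, prim_right, sub_self]⟩

end WeakDerivatives

/-! ### Scalar consequences of the energy inequalities -/

section ScalarBounds

/-- The energy inequalities in the scale-invariant quantities `a = λ² A`, `g = λ G`, `e = λ³ E`
with `λ = |t|^(1/3)`. They close because `a³` is bounded by a quantity that grows like `a^(3/2)`. -/
theorem rescaled_bounds {a g e h : ℝ} (ha : 0 ≤ a) (hg : 0 ≤ g) (he : 0 ≤ e) (hh : 0 ≤ h)
    (h1 : g ^ 2 ≤ h * a) (h2 : e ^ 2 ≤ h * e + a * g)
    (h3 : a ^ 3 ≤ 4 * h * (h * e + a * g)) :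
    a ≤ 4 * h ∧ g ≤ 2 * h ∧ e ≤ 4 * h ∧ h * e + a * g ≤ 16 * h ^ 2 := by
  have hA : a ≤ 4 * h := by
    -- With `a = p²` and `h = r²` the fractional powers become polynomial.
    obtain ⟨p, hp, rfl⟩ : ∃ p, 0 ≤ p ∧ a = p ^ 2 :=
      ⟨√a, Real.sqrt_nonneg a, (Real.sq_sqrt ha).symm⟩
    obtain ⟨r, hr, rfl⟩ : ∃ r, 0 ≤ r ∧ h = r ^ 2 :=
      ⟨√h, Real.sqrt_nonneg h, (Real.sq_sqrt hh).symm⟩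
    by_contra hcon
    have hpr : 2 * r < p := by
      by_contra h'
      have h'' : p ≤ 2 * r := not_lt.1 h'
      nlinarith
    have hgp : g ≤ r * p := by
      refine (sq_le_sq₀ hg (by positivity)).1 ?_
      linarith [mul_pow r p 2]
    have hp0 : 0 < p := by linarith
    have hr3 : 0 ≤ r ^ 3 := by positivity
    have hp3 : 0 < p ^ 3 := by positivity
    have hcube : 8 * r ^ 3 ≤ p ^ 3 := by
      calc 8 * r ^ 3 = (2 * r) ^ 3 := by ring
        _ ≤ p ^ 3 := by gcongr
    have hsum : r ^ 2 * (r ^ 2 * e + p ^ 2 * g) ≤ r ^ 3 * (r * e + p ^ 3) := by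
      calc r ^ 2 * (r ^ 2 * e + p ^ 2 * g) ≤ r ^ 2 * (r ^ 2 * e + p ^ 2 * (r * p)) := by gcongr
        _ = _ := by ring
    have hre : 0 ≤ r * e := by positivity
    have hx : (r * e) ^ 2 ≤ p ^ 3 / 8 * (r * e + p ^ 3) := by
      calc (r * e) ^ 2 = r ^ 2 * e ^ 2 := by ring
        _ ≤ r ^ 2 * (r ^ 2 * e + p ^ 2 * g) := by gcongr
        _ ≤ r ^ 3 * (r * e + p ^ 3) := hsum
        _ ≤ _ := by
          gcongr
          linarith
    have hx' : r * e ≤ p ^ 3 / 2 := by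
      by_contra h'
      have h'' : p ^ 3 / 2 < r * e := not_le.1 h'
      nlinarith
    have hfin : (p ^ 3) ^ 2 ≤ 4 * (p ^ 3 / 8 * (p ^ 3 / 2 + p ^ 3)) := by
      calc (p ^ 3) ^ 2 = (p ^ 2) ^ 3 := by ring
        _ ≤ 4 * (r ^ 2 * (r ^ 2 * e + p ^ 2 * g)) := by linarith
        _ ≤ 4 * (r ^ 3 * (r * e + p ^ 3)) := by linarith
        _ ≤ _ := by
          gcongr
          linarith
    nlinarith
  have hG : g ≤ 2 * h := by nlinarith
  have hE : e ≤ 4 * h := by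
    by_contra hcon
    have : 4 * h < e := not_le.1 hcon
    nlinarith [mul_nonneg ha hg, mul_le_mul hA hG hg (by positivity)]
  refine ⟨hA, hG, hE, ?_⟩
  nlinarith [mul_le_mul hA hG hg (by positivity)]

/-- Here `l` stands for `|t|^(1/3)`, and `A`, `B`, `G`, `D`, `E`, `h` for the norms of `F`, `√y F`,
`F'`, `√y F'`, `y F` and of the right-hand side. -/
theorem scaled_bounds {l A B G D E h : ℝ} (hl : 0 < l) (hA : 0 ≤ A) (hG : 0 ≤ G)
    (hE : 0 ≤ E) (hh : 0 ≤ h) (h1 : G ^ 2 ≤ h * A) (h2 : l ^ 3 * B ^ 2 ≤ h * A)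
    (h3 : A ^ 2 ≤ 2 * (B * D)) (h4 : l ^ 3 * E ^ 2 ≤ h * E + A * G) (h5 : D ^ 2 ≤ h * E + A * G) :
    l ^ 2 * A ≤ 4 * h ∧ l * G ≤ 2 * h ∧ l ^ 3 * E ≤ 4 * h ∧ l ^ 3 * D ^ 2 ≤ 16 * h ^ 2 := by
  have hs : l ^ 3 * (h * E + A * G) = h * (l ^ 3 * E) + (l ^ 2 * A) * (l * G) := by ring
  have key : l ^ 3 * A ^ 3 ≤ 4 * h * (h * E + A * G) := by
    rcases hA.eq_or_lt with rfl | hA'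
    · simp
      positivity
    refine le_of_mul_le_mul_left ?_ hA'
    calc A * (l ^ 3 * A ^ 3) = l ^ 3 * (A ^ 2) ^ 2 := by ring
      _ ≤ l ^ 3 * (2 * (B * D)) ^ 2 := by gcongr
      _ = 4 * (l ^ 3 * B ^ 2) * D ^ 2 := by ring
      _ ≤ 4 * (h * A) * (h * E + A * G) := by gcongr
      _ = _ := by ring
  obtain ⟨k1, k2, k3, k4⟩ := rescaled_bounds (a := l ^ 2 * A) (g := l * G) (e := l ^ 3 * E)
    (by positivity) (by positivity) (by positivity) hh
    (by
      calc (l * G) ^ 2 = l ^ 2 * G ^ 2 := by ring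
        _ ≤ l ^ 2 * (h * A) := by gcongr
        _ = _ := by ring)
    (by
      calc (l ^ 3 * E) ^ 2 = l ^ 3 * (l ^ 3 * E ^ 2) := by ring
        _ ≤ l ^ 3 * (h * E + A * G) := by gcongr
        _ = _ := hs)
    (by
      calc (l ^ 2 * A) ^ 3 = l ^ 3 * (l ^ 3 * A ^ 3) := by ring
        _ ≤ l ^ 3 * (4 * h * (h * E + A * G)) := by gcongr
        _ = 4 * h * (l ^ 3 * (h * E + A * G)) := by ring
        _ = _ := by rw [hs])
  refine ⟨k1, k2, k3, ?_⟩
  calc l ^ 3 * D ^ 2 ≤ l ^ 3 * (h * E + A * G) := by gcongr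
    _ ≤ _ := by rwa [hs]

end ScalarBounds

/-! ### The problem at a fixed frequency -/

section Frequency

variable {M : ℝ}

theorem weight_half_inner (u v : L2y M) :
    inner ℂ (weight M (1 / 2) u) (weight M (1 / 2) v) = inner ℂ u (weight M 1 v) := by
  rw [inner_weight_add, add_halves]

/-- The inequality `‖F‖² ≤ 2 ‖√y F‖ ‖√y F'‖`, from `∫ (y |F|²)' = 0`. -/
theorem norm_sq_primR_le (g : L2y M) :
    ‖primR M g‖ ^ 2 ≤ 2 * (‖weight M (1 / 2) (primR M g)‖ * ‖weight M (1 / 2) g‖) := by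
  set F := primR M g with hF
  have h1 : inner ℂ F (F + weight M 1 g) = -inner ℂ g (weight M 1 F) := by
    rw [weight_primR_eq_primL, ← inner_primR_left]
  rw [inner_add_right, inner_self_eq_norm_sq_to_K, ← weight_half_inner, ← weight_half_inner] at h1
  have h2 : ((‖F‖ : ℂ)) ^ 2 = -inner ℂ (weight M (1 / 2) g) (weight M (1 / 2) F) -
      inner ℂ (weight M (1 / 2) F) (weight M (1 / 2) g) := by
    rw [← h1]
    simp
  have h3 := congrArg norm h2
  rw [norm_pow, Complex.norm_real, norm_norm] at h3
  rw [h3]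
  refine (norm_sub_le _ _).trans ?_
  rw [norm_neg]
  have e1 := norm_inner_le_norm (𝕜 := ℂ) (weight M (1 / 2) g) (weight M (1 / 2) F)
  have e2 := norm_inner_le_norm (𝕜 := ℂ) (weight M (1 / 2) F) (weight M (1 / 2) g)
  linarith [mul_comm ‖weight M (1 / 2) g‖ ‖weight M (1 / 2) F‖]

/-- The function `i t y F - H` with `F = -∫_y^M g`, to which the equation at frequency `t` equates
`F''`. Thus `g = primL M (curvature M t g H)` says that `F` solves the boundary value problem. -/
def curvature (M t : ℝ) (g H : L2y M) : L2y M :=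
  (t * Complex.I : ℂ) • weight M 1 (primR M g) - H

variable {t : ℝ} {g H : L2y M}

/-- The equation paired with `F`. -/
theorem energy_identity (hg : g = primL M (curvature M t g H)) :
    (t * Complex.I : ℂ) * (‖weight M (1 / 2) (primR M g)‖ : ℂ) ^ 2 + (‖g‖ : ℂ) ^ 2 =
      inner ℂ (primR M g) H := by
  have h1 : inner ℂ (primR M g) (curvature M t g H) = -(‖g‖ : ℂ) ^ 2 := by
    rw [inner_primR_left, ← hg, inner_self_eq_norm_sq_to_K]
    simp
  rw [curvature, inner_sub_right, inner_smul_right, ← weight_half_inner,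
    inner_self_eq_norm_sq_to_K] at h1
  simp only [Complex.coe_algebraMap] at h1
  linear_combination h1

/-- The equation paired with `y F`. -/
theorem weighted_energy_identity (hg : g = primL M (curvature M t g H)) :
    (t * Complex.I : ℂ) * (‖weight M 1 (primR M g)‖ : ℂ) ^ 2 +
      (‖weight M (1 / 2) g‖ : ℂ) ^ 2 =
      inner ℂ (weight M 1 (primR M g)) H - inner ℂ (primR M g) g := by
  have h1 : inner ℂ (weight M 1 (primR M g)) (curvature M t g H) =
      -(inner ℂ (primR M g) g + (‖weight M (1 / 2) g‖ : ℂ) ^ 2) := by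
    have h2 := (isSelfAdjoint_weight (M := M) 1).isSymmetric g g
    simp only [ContinuousLinearMap.coe_coe] at h2
    rw [weight_primR_eq_primR, inner_primR_left, ← hg, inner_add_left, h2, ← weight_half_inner,
      inner_self_eq_norm_sq_to_K]
    simp
  rw [curvature, inner_sub_right, inner_smul_right, inner_self_eq_norm_sq_to_K] at h1
  simp only [Complex.coe_algebraMap] at h1
  linear_combination h1

theorem re_im_le_of_eq {a b t : ℝ} {z : ℂ}
    (h : (t * Complex.I : ℂ) * (a : ℂ) ^ 2 + (b : ℂ) ^ 2 = z) :
    b ^ 2 ≤ ‖z‖ ∧ |t| * a ^ 2 ≤ ‖z‖ := by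
  have hre : z.re = b ^ 2 := by
    rw [← h]
    simp [← Complex.ofReal_pow]
  have him : z.im = t * a ^ 2 := by
    rw [← h]
    simp [← Complex.ofReal_pow]
  refine ⟨hre ▸ (le_abs_self _).trans (Complex.abs_re_le_norm z), ?_⟩
  have := Complex.abs_im_le_norm z
  rwa [him, abs_mul, abs_of_nonneg (sq_nonneg a)] at this

theorem norm_flux_sq_le (hg : g = primL M (curvature M t g H)) :
    ‖g‖ ^ 2 ≤ ‖H‖ * ‖primR M g‖ := by
  refine (re_im_le_of_eq (energy_identity hg)).1.trans ?_
  rw [mul_comm]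
  exact norm_inner_le_norm _ _

theorem norm_flux_le (hg : g = primL M (curvature M t g H)) : ‖g‖ ≤ |M| * ‖H‖ := by
  have h1 := norm_flux_sq_le hg
  have h2 : ‖primR M g‖ ≤ |M| * ‖g‖ := (primR M).le_of_opNorm_le norm_primR_le g
  rcases (norm_nonneg g).eq_or_lt with h0 | h0
  · rw [← h0]
    positivity
  · refine le_of_mul_le_mul_left ?_ h0
    nlinarith [mul_le_mul_of_nonneg_left h2 (norm_nonneg H)]

theorem norm_primR_flux_le (hg : g = primL M (curvature M t g H)) :
    ‖primR M g‖ ≤ M ^ 2 * ‖H‖ := by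
  have h2 : ‖primR M g‖ ≤ |M| * ‖g‖ := (primR M).le_of_opNorm_le norm_primR_le g
  refine h2.trans ?_
  rw [← sq_abs M, sq, mul_assoc]
  exact mul_le_mul_of_nonneg_left (norm_flux_le hg) (abs_nonneg M)

theorem frequency_bounds (ht : t ≠ 0) (hg : g = primL M (curvature M t g H)) :
    |t| ^ (2 / 3 : ℝ) * ‖primR M g‖ ≤ 4 * ‖H‖ ∧ |t| ^ (1 / 3 : ℝ) * ‖g‖ ≤ 2 * ‖H‖ ∧
      |t| * ‖weight M 1 (primR M g)‖ ≤ 4 * ‖H‖ ∧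
      |t| ^ (1 / 2 : ℝ) * ‖weight M (1 / 2) g‖ ≤ 4 * ‖H‖ := by
  have hT : 0 < |t| := abs_pos.2 ht
  have hl : 0 < |t| ^ (1 / 3 : ℝ) := Real.rpow_pos_of_pos hT _
  have hl3 : (|t| ^ (1 / 3 : ℝ)) ^ 3 = |t| := by
    rw [← Real.rpow_natCast, ← Real.rpow_mul hT.le]
    norm_num
  have hl2 : (|t| ^ (1 / 3 : ℝ)) ^ 2 = |t| ^ (2 / 3 : ℝ) := by
    rw [← Real.rpow_natCast, ← Real.rpow_mul hT.le]
    norm_num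
  have hz : ‖inner ℂ (weight M 1 (primR M g)) H - inner ℂ (primR M g) g‖ ≤
      ‖H‖ * ‖weight M 1 (primR M g)‖ + ‖primR M g‖ * ‖g‖ := by
    refine (norm_sub_le _ _).trans (add_le_add ?_ (norm_inner_le_norm _ _))
    rw [mul_comm]
    exact norm_inner_le_norm _ _
  have hE := re_im_le_of_eq (energy_identity hg)
  have hW := re_im_le_of_eq (weighted_energy_identity hg)
  have hF : ‖inner ℂ (primR M g) H‖ ≤ ‖H‖ * ‖primR M g‖ := by
    rw [mul_comm]
    exact norm_inner_le_norm _ _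
  obtain ⟨k1, k2, k3, k4⟩ := scaled_bounds hl (norm_nonneg (primR M g))
    (norm_nonneg g) (norm_nonneg (weight M 1 (primR M g))) (norm_nonneg H)
    (hE.1.trans hF) (by rw [hl3]; exact hE.2.trans hF) (norm_sq_primR_le g)
    (by rw [hl3]; exact hW.2.trans hz) (hW.1.trans hz)
  rw [hl2] at k1
  rw [hl3] at k3 k4
  refine ⟨k1, k2, k3, ?_⟩
  refine (sq_le_sq₀ (by positivity) (by positivity)).1 ?_
  rw [mul_pow, ← Real.sqrt_eq_rpow, Real.sq_sqrt hT.le]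
  linarith

theorem norm_curvature_le (ht : t ≠ 0) (hg : g = primL M (curvature M t g H)) :
    ‖curvature M t g H‖ ≤ 5 * ‖H‖ := by
  refine (norm_sub_le _ _).trans ?_
  rw [norm_smul, norm_mul, Complex.norm_I, mul_one, Complex.norm_real, Real.norm_eq_abs]
  linarith [(frequency_bounds ht hg).2.2.1]

/-- The two cases `|t| M³ ≤ 1` and `|t| M³ ≥ 1` use `‖F‖ ≤ M² ‖H‖` and `|t|^(2/3) ‖F‖ ≤ 4 ‖H‖`
respectively; the weight is estimated by `y ≤ M`. -/
theorem norm_weight_sixth_le (hM : 0 < M) (ht : t ≠ 0) (hg : g = primL M (curvature M t g H)) :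
    |t| ^ (1 / 18 : ℝ) * ‖weight M (1 / 6) (primR M g)‖ ≤ 4 * M ^ 2 * ‖H‖ := by
  have hT : 0 < |t| := abs_pos.2 ht
  have h1 : ‖weight M (1 / 6) (primR M g)‖ ≤ M ^ (1 / 6 : ℝ) * ‖primR M g‖ := by
    have h := (weight M (1 / 6)).le_of_opNorm_le (norm_weight_le (1 / 6)) (primR M g)
    rw [abs_of_pos hM] at h
    simpa using h
  have h2 : |t| ^ (1 / 18 : ℝ) * M ^ (1 / 6 : ℝ) = (|t| * M ^ 3) ^ (1 / 18 : ℝ) := by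
    rw [Real.mul_rpow hT.le (by positivity), ← Real.rpow_natCast M 3, ← Real.rpow_mul hM.le]
    norm_num
  have h3 : (|t| * M ^ 3) ^ (2 / 3 : ℝ) = |t| ^ (2 / 3 : ℝ) * M ^ 2 := by
    rw [Real.mul_rpow hT.le (by positivity), ← Real.rpow_natCast M 3, ← Real.rpow_mul hM.le]
    norm_num
  calc |t| ^ (1 / 18 : ℝ) * ‖weight M (1 / 6) (primR M g)‖
      ≤ |t| ^ (1 / 18 : ℝ) * (M ^ (1 / 6 : ℝ) * ‖primR M g‖) := by gcongr
    _ = (|t| * M ^ 3) ^ (1 / 18 : ℝ) * ‖primR M g‖ := by rw [← mul_assoc, h2]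
    _ ≤ 4 * M ^ 2 * ‖H‖ := by
      rcases le_total (|t| * M ^ 3) 1 with h | h
      · have h4 : (|t| * M ^ 3) ^ (1 / 18 : ℝ) ≤ 1 :=
          Real.rpow_le_one (by positivity) h (by norm_num)
        calc _ ≤ 1 * (M ^ 2 * ‖H‖) := by
              gcongr
              exact norm_primR_flux_le hg
          _ ≤ _ := by nlinarith [show 0 ≤ M ^ 2 * ‖H‖ by positivity]
      · have h4 : (|t| * M ^ 3) ^ (1 / 18 : ℝ) ≤ (|t| * M ^ 3) ^ (2 / 3 : ℝ) :=
          Real.rpow_le_rpow_of_exponent_le h (by norm_num)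
        calc _ ≤ (|t| ^ (2 / 3 : ℝ) * M ^ 2) * ‖primR M g‖ := by
              rw [← h3]
              gcongr
          _ = M ^ 2 * (|t| ^ (2 / 3 : ℝ) * ‖primR M g‖) := by ring
          _ ≤ M ^ 2 * (4 * ‖H‖) := by
              exact mul_le_mul_of_nonneg_left (frequency_bounds ht hg).1 (sq_nonneg M)
          _ = _ := by ring

/-- The self-adjoint operator `K* y K` with `K u = -∫_y^M u`. -/
def weightedGram (M : ℝ) : L2y M →L[ℂ] L2y M :=
  ContinuousLinearMap.adjoint (primR M) ∘L weight M 1 ∘L primR M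

theorem isSelfAdjoint_weightedGram : IsSelfAdjoint (weightedGram M) :=
  (isSelfAdjoint_weight 1).adjoint_conj (primR M)

theorem weightedGram_apply (u : L2y M) :
    weightedGram M u = -primL M (weight M 1 (primR M u)) := by
  simp [weightedGram, primR]

/-- The solution operator `H ↦ ∂_y F` of `i t y F - ∂_y² F = H`, `∂_y F(0) = 0`, `F(M) = 0`. The
`Ring.inverse` is a true inverse, by `isUnit_one_add_I_smul`. -/
def flux (M t : ℝ) : L2y M →L[ℂ] L2y M :=
  Ring.inverse (1 + (t * Complex.I : ℂ) • weightedGram M) ∘L (-primL M)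

theorem eq_flux_iff : g = flux M t H ↔ g = primL M (curvature M t g H) := by
  have hu := isUnit_one_add_I_smul (isSelfAdjoint_weightedGram (M := M)) t
  have h1 : g = flux M t H ↔ (1 + (t * Complex.I : ℂ) • weightedGram M) g = -primL M H := by
    constructor
    · rintro rfl
      exact DFunLike.congr_fun (Ring.mul_inverse_cancel _ hu) (-primL M H)
    · intro h
      have h2 := DFunLike.congr_fun (Ring.inverse_mul_cancel _ hu) g
      rw [flux, ContinuousLinearMap.comp_apply, neg_apply, ← h]
      exact h2.symm
  have h2 : (1 + (t * Complex.I : ℂ) • weightedGram M) g =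
      g - (t * Complex.I : ℂ) • primL M (weight M 1 (primR M g)) := by
    rw [add_apply, smul_apply, weightedGram_apply, smul_neg, ← sub_eq_add_neg]
    rfl
  rw [h1, h2, curvature, map_sub, map_smul, sub_eq_iff_eq_add, neg_add_eq_sub]

theorem continuous_flux : Continuous (flux M) :=
  (continuous_inverse_one_add_I_smul isSelfAdjoint_weightedGram).clm_comp continuous_const

end Frequency

/-! ### Comparison of the anisotropic norms -/

section FrequencyNorms

variable {M : ℝ}

theorem lintegral_enorm_sq_eq {α E : Type*} [MeasurableSpace α] [NormedAddCommGroup E]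
    {μ : Measure α} (v : Lp E 2 μ) : ∫⁻ y, ‖v y‖ₑ ^ 2 ∂μ = ‖v‖ₑ ^ 2 := by
  rw [Lp.enorm_def, eLpNorm_eq_lintegral_rpow_enorm_toReal (by norm_num) (by norm_num),
    ← ENNReal.rpow_natCast, ← ENNReal.rpow_mul]
  simp

theorem lintegral_weight (r : ℝ) (hr : 0 ≤ r) (k : ℝ≥0) (u : L2y M) :
    ∫⁻ y in Ioo 0 M, ‖((r * y ^ (k : ℝ) : ℝ) : ℂ) * u y‖ₑ ^ 2 =
      ENNReal.ofReal (r * ‖weight M k u‖) ^ 2 := by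
  have h1 : ENNReal.ofReal (r * ‖weight M k u‖) = ‖(r : ℂ) • weight M k u‖ₑ := by
    rw [← ofReal_norm, norm_smul, Complex.norm_real, Real.norm_of_nonneg hr]
  rw [h1, ← lintegral_enorm_sq_eq]
  refine lintegral_congr_ae ?_
  filter_upwards [Lp.coeFn_smul (r : ℂ) (weight M k u), coeFn_weight k u] with y h2 h3
  rw [h2, Pi.smul_apply, h3, smul_eq_mul, ← mul_assoc, ← Complex.ofReal_mul]

theorem freqNorm_eq (s : ℝ) (k : ℝ≥0) (g : ℝ → L2y M) :
    freqNorm M s k g =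
      (∫⁻ ξ : ℝ, ENNReal.ofReal (|2 * Real.pi * ξ| ^ s * ‖weight M k (g ξ)‖) ^ 2) ^ (1 / 2 : ℝ) := by
  rw [freqNorm]
  congr 1
  exact lintegral_congr fun ξ ↦ lintegral_weight _ (by positivity) k (g ξ)

theorem freqNorm_zero_eq (s : ℝ) (g : ℝ → L2y M) :
    freqNorm M s 0 g =
      (∫⁻ ξ : ℝ, ENNReal.ofReal (|2 * Real.pi * ξ| ^ s * ‖g ξ‖) ^ 2) ^ (1 / 2 : ℝ) := by
  have h := freqNorm_eq s 0 g
  rw [weight_zero] at h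
  exact h

theorem sq_rpow_half (a : ℝ≥0∞) : (a ^ 2) ^ (1 / 2 : ℝ) = a := by
  rw [← ENNReal.rpow_natCast, ← ENNReal.rpow_mul]
  simp

theorem freqNorm_le {s s' C : ℝ} (hC : 0 ≤ C) (k : ℝ≥0) {g H : ℝ → L2y M}
    (h : ∀ᵐ ξ, |2 * Real.pi * ξ| ^ s * ‖weight M k (g ξ)‖ ≤
      C * (|2 * Real.pi * ξ| ^ s' * ‖H ξ‖)) :
    freqNorm M s k g ≤ ENNReal.ofReal C * freqNorm M s' 0 H := by
  rw [freqNorm_eq, freqNorm_zero_eq]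
  calc _ ≤ (∫⁻ ξ : ℝ, ENNReal.ofReal C ^ 2 *
        ENNReal.ofReal (|2 * Real.pi * ξ| ^ s' * ‖H ξ‖) ^ 2) ^ (1 / 2 : ℝ) := by
        refine ENNReal.rpow_le_rpow (lintegral_mono_ae ?_) (by norm_num)
        filter_upwards [h] with ξ hξ
        rw [← mul_pow, ← ENNReal.ofReal_mul hC]
        gcongr
    _ = _ := by
        rw [lintegral_const_mul' _ _ (by finiteness), ENNReal.mul_rpow_of_nonneg _ _ (by norm_num),
          sq_rpow_half]

theorem freqNorm_zero_zero (f : L2Strip M) : freqNorm M 0 0 f = ‖f‖ₑ := by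
  rw [freqNorm_zero_eq, ← sq_rpow_half ‖f‖ₑ, ← lintegral_enorm_sq_eq]
  congr 1
  refine lintegral_congr fun ξ ↦ ?_
  rw [Real.rpow_zero, one_mul, ofReal_norm]

theorem enorm_fourier_eq (f : L2Strip M) : ‖(𝓕 f : L2Strip M)‖ₑ = ‖f‖ₑ := by
  rw [← ofReal_norm, ← ofReal_norm, Lp.norm_fourier_eq]

theorem fracNorm_zero_zero (f : L2Strip M) : fracNorm 0 0 f = ‖f‖ₑ := by
  rw [fracNorm, freqNorm_zero_zero, enorm_fourier_eq]

theorem fracNorm_lt_top_of_memSobolev {s : ℝ} (hs : 0 ≤ s) {h : L2Strip M}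
    (hh : TemperedDistribution.MemSobolev s 2 (h : 𝓢'(ℝ, L2y M))) : fracNorm s 0 h < ⊤ := by
  obtain ⟨g, hg⟩ := exists_rpow_smul_fourier_of_memSobolev hh
  have key : fracNorm s 0 h ≤ ENNReal.ofReal ((2 * Real.pi) ^ s) * freqNorm M 0 0 g := by
    refine freqNorm_le (by positivity) 0 ?_
    filter_upwards [hg] with ξ hξ
    rw [← hξ, norm_smul, Complex.norm_real, Real.norm_of_nonneg (by positivity), Real.rpow_zero,
      one_mul, weight_zero, ContinuousLinearMap.id_apply, ← mul_assoc]
    refine mul_le_mul_of_nonneg_right ?_ (norm_nonneg _)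
    rw [abs_mul, abs_of_pos Real.two_pi_pos, Real.mul_rpow (by positivity) (abs_nonneg _)]
    refine mul_le_mul_of_nonneg_left ?_ (by positivity)
    calc |ξ| ^ s = (|ξ| ^ 2) ^ (s / 2) := by
          rw [← Real.rpow_natCast, ← Real.rpow_mul (abs_nonneg _)]
          congr 1
          push_cast
          ring
      _ ≤ (1 + ‖ξ‖ ^ 2) ^ (s / 2) := by
          refine Real.rpow_le_rpow (by positivity) ?_ (by linarith)
          rw [Real.norm_eq_abs]
          linarith
  refine key.trans_lt ?_
  rw [freqNorm_zero_zero]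
  exact ENNReal.mul_lt_top ENNReal.ofReal_lt_top enorm_lt_top

theorem fracDerivNorm_le (s k : ℝ) (j : ℕ) {f v : L2Strip M}
    (h : ∀ᵐ ξ, HasWeakDeriv M j ((𝓕 f : L2Strip M) ξ) (v ξ)) :
    fracDerivNorm s k j f ≤ freqNorm M s k v :=
  iInf_le_of_le v (iInf_le_of_le (Lp.aestronglyMeasurable v) (iInf_le_of_le h le_rfl))

end FrequencyNorms

/-! ### Solutions on the strip -/

section Solution

variable {M : ℝ}

/-- The flux `g = ∂_y f` of a solution with data `h`, prescribed on the Fourier side. -/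
def IsFlux (g h : L2Strip M) : Prop :=
  ∀ᵐ ξ : ℝ, (𝓕 g : L2Strip M) ξ = flux M (2 * Real.pi * ξ) ((𝓕 h : L2Strip M) ξ)

theorem IsFlux.eq_primL {g h : L2Strip M} (hg : IsFlux g h) :
    ∀ᵐ ξ : ℝ, (𝓕 g : L2Strip M) ξ = primL M (curvature M (2 * Real.pi * ξ)
      ((𝓕 g : L2Strip M) ξ) ((𝓕 h : L2Strip M) ξ)) := by
  filter_upwards [hg] with ξ hξ
  exact eq_flux_iff.1 hξ

theorem IsFlux.unique {g₁ g₂ h : L2Strip M} (h₁ : IsFlux g₁ h) (h₂ : IsFlux g₂ h) : g₁ = g₂ := by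
  have h3 : (𝓕 g₁ : L2Strip M) = 𝓕 g₂ := by
    refine Lp.ext ?_
    filter_upwards [h₁, h₂] with ξ e1 e2
    rw [e1, e2]
  exact (Lp.fourierTransformₗᵢ ℝ (L2y M)).injective h3

theorem exists_fourier_eq {F : ℝ → L2y M} (hF : MemLp F 2 volume) :
    ∃ f : L2Strip M, (𝓕 f : L2Strip M) =ᵐ[volume] F := by
  refine ⟨𝓕⁻ hF.toLp, ?_⟩
  rw [FourierTransform.fourier_fourierInv_eq]
  exact hF.coeFn_toLp

theorem exists_isFlux (h : L2Strip M) : ∃ g : L2Strip M, IsFlux g h := by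
  have hm : AEStronglyMeasurable
      (fun ξ : ℝ ↦ flux M (2 * Real.pi * ξ) ((𝓕 h : L2Strip M) ξ)) volume := by
    have h1 : Continuous fun ξ : ℝ ↦ flux M (2 * Real.pi * ξ) :=
      continuous_flux.comp (by fun_prop)
    exact (ContinuousLinearMap.id ℂ (L2y M →L[ℂ] L2y M)).aestronglyMeasurable_comp₂
      h1.aestronglyMeasurable (Lp.aestronglyMeasurable _)
  exact exists_fourier_eq ((Lp.memLp (𝓕 h : L2Strip M)).of_le_mul hm
    (Filter.Eventually.of_forall fun ξ ↦ norm_flux_le (eq_flux_iff.1 rfl)))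

theorem ae_two_pi_mul_ne_zero : ∀ᵐ ξ : ℝ, 2 * Real.pi * ξ ≠ 0 := by
  filter_upwards [compl_mem_ae_iff.2 (measure_singleton (0 : ℝ))] with ξ hξ
  exact mul_ne_zero Real.two_pi_pos.ne' hξ

theorem fourier_primR (g : L2Strip M) :
    ∀ᵐ ξ, (𝓕 ((primR M).compLpL 2 volume g) : L2Strip M) ξ = primR M ((𝓕 g : L2Strip M) ξ) := by
  rw [fourier_compLpL]
  exact (primR M).coeFn_compLpL _

/-- The second derivative `q = ∂_y² f` of the solution exists in `L²` of the strip. -/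
theorem IsFlux.exists_curvature {g h : L2Strip M} (hg : IsFlux g h) :
    ∃ q : L2Strip M, g = (primL M).compLpL 2 volume q ∧
      ∀ᵐ ξ : ℝ, (𝓕 q : L2Strip M) ξ = curvature M (2 * Real.pi * ξ)
        ((𝓕 g : L2Strip M) ξ) ((𝓕 h : L2Strip M) ξ) := by
  have hm : AEStronglyMeasurable (fun ξ : ℝ ↦ curvature M (2 * Real.pi * ξ)
      ((𝓕 g : L2Strip M) ξ) ((𝓕 h : L2Strip M) ξ)) volume := by
    have h1 : AEStronglyMeasurable
        (fun ξ : ℝ ↦ (((2 * Real.pi * ξ : ℝ) : ℂ) * Complex.I)) volume :=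
      Continuous.aestronglyMeasurable (by fun_prop)
    have h2 : AEStronglyMeasurable
        (fun ξ : ℝ ↦ weight M 1 (primR M ((𝓕 g : L2Strip M) ξ))) volume :=
      (weight M 1 ∘L primR M).continuous.comp_aestronglyMeasurable
        (Lp.aestronglyMeasurable (𝓕 g : L2Strip M))
    exact (h1.smul h2).sub (Lp.aestronglyMeasurable _)
  obtain ⟨q, hq⟩ := exists_fourier_eq ((Lp.memLp (𝓕 h : L2Strip M)).of_le_mul (c := 5) hm (by
    filter_upwards [hg.eq_primL, ae_two_pi_mul_ne_zero] with ξ h1 h2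
    exact norm_curvature_le h2 h1))
  refine ⟨q, ?_, hq⟩
  refine (Lp.fourierTransformₗᵢ ℝ (L2y M)).injective ?_
  change (𝓕 g : L2Strip M) = 𝓕 ((primL M).compLpL 2 volume q)
  rw [fourier_compLpL]
  refine Lp.ext ?_
  filter_upwards [hg.eq_primL, hq, (primL M).coeFn_compLpL (𝓕 q : L2Strip M)] with ξ h1 h2 h3
  rw [h3, h2, ← h1]

theorem fourier_weight_primR (g : L2Strip M) :
    ∀ᵐ ξ, (𝓕 ((weight M 1).compLpL 2 volume ((primR M).compLpL 2 volume g)) : L2Strip M) ξ =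
      weight M 1 (primR M ((𝓕 g : L2Strip M) ξ)) := by
  rw [fourier_compLpL]
  filter_upwards [(weight M 1).coeFn_compLpL (𝓕 ((primR M).compLpL 2 volume g) : L2Strip M),
    fourier_primR g] with ξ h1 h2
  rw [h1, h2]

theorem fourier_add_ae (q h : L2Strip M) :
    ∀ᵐ ξ, (𝓕 (q + h : L2Strip M) : L2Strip M) ξ = (𝓕 q : L2Strip M) ξ + (𝓕 h : L2Strip M) ξ := by
  rw [FourierTransform.fourier_add]
  exact Lp.coeFn_add _ _

theorem IsFlux.isSolution (hM : 0 < M) {g h : L2Strip M} (hg : IsFlux g h) :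
    IsSolution ((primR M).compLpL 2 volume g) h := by
  obtain ⟨q, hgq, hq⟩ := hg.exists_curvature
  have hfx : ∀ᵐ x, (primR M).compLpL 2 volume g x = primR M (g x) := (primR M).coeFn_compLpL g
  have hgx : ∀ᵐ x, g x = primL M (q x) := by
    have := (primL M).coeFn_compLpL (p := 2) (μ := volume) q
    rwa [← hgq] at this
  refine ⟨⟨(weight M 1).compLpL 2 volume ((primR M).compLpL 2 volume g), q, ?_, ?_, ?_⟩,
    ⟨g, ?_, ?_⟩, ?_⟩
  · filter_upwards [(weight M 1).coeFn_compLpL ((primR M).compLpL 2 volume g)] with x hx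
    rw [hx]
    exact coeFn_weight_one _
  · filter_upwards [hfx, hgx] with x h1 h2
    rw [h1]
    refine (hasWeakDeriv_primR hM.le (g x)).two_of_one ?_
    rw [h2]
    exact hasWeakDeriv_primL hM.le (q x)
  · rw [lineDeriv_eq_iff]
    filter_upwards [fourier_weight_primR g, fourier_add_ae q h, hq] with ξ h1 h2 h3
    rw [h1, h2, h3, curvature, sub_add_cancel]
    push_cast
    rfl
  · filter_upwards [hfx] with x h1
    rw [h1]
    exact hasWeakDeriv_primR hM.le (g x)
  · filter_upwards [hgx] with x h1
    rw [h1]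
    exact hasTrace_primL (q x)
  · filter_upwards [hfx] with x h1
    rw [h1]
    exact hasTrace_primR (g x)

/-- Every solution arises from the solution operators at the single frequencies. This gives
uniqueness, without the finiteness of any norm of `f` beyond `L²`. -/
theorem IsSolution.exists_isFlux (hM : 0 < M) {f h : L2Strip M} (hf : IsSolution f h) :
    ∃ g : L2Strip M, IsFlux g h ∧ f = (primR M).compLpL 2 volume g := by
  obtain ⟨⟨w, q, hw, hq, hwq⟩, ⟨g, hg, hg0⟩, hfM⟩ := hf
  have hfg : f = (primR M).compLpL 2 volume g := by
    refine Lp.ext ?_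
    filter_upwards [hg, hfM, (primR M).coeFn_compLpL g] with x h1 h2 h3
    rw [h3]
    exact eq_primR_of_hasWeakDeriv hM h1 h2
  have hgq : g = (primL M).compLpL 2 volume q := by
    refine Lp.ext ?_
    filter_upwards [hg, hg0, hq, (primL M).coeFn_compLpL q] with x h1 h2 h3 h4
    rw [h4]
    exact eq_primL_of_hasWeakDeriv hM (h1.one_of_two h3) h2
  have hwf : w = (weight M 1).compLpL 2 volume f := by
    refine Lp.ext ?_
    filter_upwards [hw, (weight M 1).coeFn_compLpL f] with x h1 h2
    rw [h2]
    refine Lp.ext ?_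
    filter_upwards [h1, coeFn_weight_one (f x)] with y h3 h4
    rw [h3, h4]
  refine ⟨g, ?_, hfg⟩
  rw [lineDeriv_eq_iff, hwf, hfg] at hwq
  have hgq' : ∀ᵐ ξ, (𝓕 g : L2Strip M) ξ = primL M ((𝓕 q : L2Strip M) ξ) := by
    have := (primL M).coeFn_compLpL (𝓕 q : L2Strip M)
    rwa [← fourier_compLpL, ← hgq] at this
  filter_upwards [hwq, fourier_weight_primR g, fourier_add_ae q h, hgq'] with ξ h1 h2 h3 h4
  rw [eq_flux_iff]
  rw [h2, h3] at h1
  have h5 : curvature M (2 * Real.pi * ξ) ((𝓕 g : L2Strip M) ξ) ((𝓕 h : L2Strip M) ξ) =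
      (𝓕 q : L2Strip M) ξ := by
    rw [curvature, sub_eq_iff_eq_add, ← h1]
    push_cast
    rfl
  rw [h5, h4]

theorem mul_rpow_add_le {T s a x y C : ℝ} (hT : 0 < T) (h : T ^ s * x ≤ C * y) :
    T ^ (s + a) * x ≤ C * (T ^ a * y) := by
  calc T ^ (s + a) * x = T ^ a * (T ^ s * x) := by rw [Real.rpow_add hT]; ring
    _ ≤ T ^ a * (C * y) := by gcongr
    _ = _ := by ring

theorem IsFlux.normY_le (hM : 0 < M) {g h : L2Strip M} (hg : IsFlux g h) (a : ℝ) :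
    normY a ((primR M).compLpL 2 volume g) ≤ 19 * fracNorm (a / 2) 0 h := by
  obtain ⟨q, -, hq⟩ := hg.exists_curvature
  set f : L2Strip M := (primR M).compLpL 2 volume g with hf
  have hf' := fourier_primR g
  have hgJ := hg.eq_primL
  have hd1 : ∀ᵐ ξ, HasWeakDeriv M 1 ((𝓕 f : L2Strip M) ξ) ((𝓕 g : L2Strip M) ξ) := by
    filter_upwards [hf'] with ξ h1
    rw [h1]
    exact hasWeakDeriv_primR hM.le _
  have hd2 : ∀ᵐ ξ, HasWeakDeriv M 2 ((𝓕 f : L2Strip M) ξ) ((𝓕 q : L2Strip M) ξ) := by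
    filter_upwards [hd1, hgJ, hq] with ξ h1 h2 h3
    refine h1.two_of_one ?_
    rw [h2, h3]
    exact hasWeakDeriv_primL hM.le _
  have b1 : fracNorm (1 + a / 2) 1 f ≤ ENNReal.ofReal 4 * fracNorm (a / 2) 0 h := by
    rw [fracNorm, ← NNReal.coe_one]
    refine freqNorm_le (by norm_num) 1 ?_
    filter_upwards [hf', hgJ, ae_two_pi_mul_ne_zero] with ξ h1 h2 h3
    rw [h1]
    refine mul_rpow_add_le (abs_pos.2 h3) ?_
    rw [NNReal.coe_one, Real.rpow_one]
    exact (frequency_bounds h3 h2).2.2.1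
  have b2 : fracNorm (2 / 3 + a / 2) 0 f ≤ ENNReal.ofReal 4 * fracNorm (a / 2) 0 h := by
    refine freqNorm_le (by norm_num) 0 ?_
    filter_upwards [hf', hgJ, ae_two_pi_mul_ne_zero] with ξ h1 h2 h3
    rw [h1, weight_zero]
    exact mul_rpow_add_le (abs_pos.2 h3) (frequency_bounds h3 h2).1
  have b3 : fracDerivNorm (1 / 3 + a / 2) 0 1 f ≤ ENNReal.ofReal 2 * fracNorm (a / 2) 0 h := by
    refine (fracDerivNorm_le _ _ _ hd1).trans (freqNorm_le (by norm_num) 0 ?_)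
    filter_upwards [hgJ, ae_two_pi_mul_ne_zero] with ξ h2 h3
    rw [weight_zero]
    exact mul_rpow_add_le (abs_pos.2 h3) (frequency_bounds h3 h2).2.1
  have b4 : fracDerivNorm (a / 2) 0 2 f ≤ ENNReal.ofReal 5 * fracNorm (a / 2) 0 h := by
    refine (fracDerivNorm_le _ _ _ hd2).trans (freqNorm_le (by norm_num) 0 ?_)
    filter_upwards [hgJ, hq, ae_two_pi_mul_ne_zero] with ξ h1 h2 h3
    rw [weight_zero, h2, ContinuousLinearMap.id_apply, mul_left_comm]
    exact mul_le_mul_of_nonneg_left (norm_curvature_le h3 h1) (by positivity)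
  have b5 : fracDerivNorm ((1 + a) / 2) (1 / 2) 1 f ≤
      ENNReal.ofReal 4 * fracNorm (a / 2) 0 h := by
    refine (fracDerivNorm_le _ _ _ hd1).trans ?_
    rw [show (1 / 2 : ℝ) = ((1 / 2 : ℝ≥0) : ℝ) by push_cast; rfl, add_div]
    refine freqNorm_le (by norm_num) (1 / 2) ?_
    filter_upwards [hgJ, ae_two_pi_mul_ne_zero] with ξ h2 h3
    exact mul_rpow_add_le (abs_pos.2 h3) (frequency_bounds h3 h2).2.2.2
  calc normY a f ≤ _ := add_le_add (add_le_add (add_le_add (add_le_add b1 b2) b3) b4) b5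
    _ = 19 * fracNorm (a / 2) 0 h := by
      simp only [ENNReal.ofReal_ofNat]
      ring

theorem IsFlux.normX_le (hM : 0 < M) {g h : L2Strip M} (hg : IsFlux g h) (a : ℝ) :
    normX a ((primR M).compLpL 2 volume g) ≤
      5 * (ENNReal.ofReal (M ^ 2) * ‖h‖ₑ) + 19 * fracNorm (a / 2) 0 h := by
  have hf' := fourier_primR g
  have hgJ := hg.eq_primL
  set f : L2Strip M := (primR M).compLpL 2 volume g
  have b1 : ‖f‖ₑ ≤ ENNReal.ofReal (M ^ 2) * ‖h‖ₑ := by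
    rw [← fracNorm_zero_zero f, ← fracNorm_zero_zero h]
    refine freqNorm_le (by positivity) 0 ?_
    filter_upwards [hf', hgJ] with ξ h1 h2
    rw [h1, weight_zero, Real.rpow_zero, one_mul, one_mul]
    exact norm_primR_flux_le h2
  have b2 : fracNorm (1 / 18) (1 / 6) f ≤ ENNReal.ofReal (4 * M ^ 2) * ‖h‖ₑ := by
    rw [← fracNorm_zero_zero h, fracNorm, show (1 / 6 : ℝ) = ((1 / 6 : ℝ≥0) : ℝ) by push_cast; rfl]
    refine freqNorm_le (by positivity) (1 / 6) ?_
    filter_upwards [hf', hgJ, ae_two_pi_mul_ne_zero] with ξ h1 h2 h3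
    rw [h1, Real.rpow_zero, one_mul]
    exact norm_weight_sixth_le hM h3 h2
  rw [ENNReal.ofReal_mul (by norm_num), ENNReal.ofReal_ofNat] at b2
  calc normX a f ≤ _ := add_le_add (add_le_add b1 b2) (hg.normY_le hM a)
    _ = _ := by ring

theorem IsFlux.normXInter_le (hM : 0 < M) {g h : L2Strip M} (hg : IsFlux g h) (a : ℝ) :
    normXInter 0 a ((primR M).compLpL 2 volume g) ≤
      19 * (ENNReal.ofReal (1 + M ^ 2) * ‖h‖ₑ + fracNorm (a / 2) 0 h) := by
  have h0 := hg.normX_le hM 0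
  rw [zero_div, fracNorm_zero_zero] at h0
  rw [ENNReal.ofReal_add zero_le_one (sq_nonneg M), ENNReal.ofReal_one]
  calc normXInter 0 a _ ≤ _ := add_le_add h0 (hg.normX_le hM a)
    _ = 10 * (ENNReal.ofReal (M ^ 2) * ‖h‖ₑ) + 19 * (‖h‖ₑ + fracNorm (a / 2) 0 h) := by ring
    _ ≤ 19 * (ENNReal.ofReal (M ^ 2) * ‖h‖ₑ) + 19 * (‖h‖ₑ + fracNorm (a / 2) 0 h) := by
      gcongr
      norm_num
    _ = _ := by ring

end Solution

end TripleDeck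

end

theorem lemma3p1 :
    ∃ C : ℝ≥0, ∀ (α : ℝ), 0 < α → ∀ (M : ℝ), 0 < M → ∀ h : TripleDeck.L2Strip M,
      TemperedDistribution.MemSobolev (α / 2) 2 (h : 𝓢'(ℝ, TripleDeck.L2y M)) →
        (∃! f : TripleDeck.L2Strip M, TripleDeck.MemXInter 0 α f ∧ TripleDeck.IsSolution f h) ∧
        ∀ f : TripleDeck.L2Strip M, TripleDeck.MemXInter 0 α f → TripleDeck.IsSolution f h →
          TripleDeck.normXInter 0 α f ≤
            (C : ℝ≥0∞) * (ENNReal.ofReal (1 + M ^ 2) * ‖h‖ₑ + TripleDeck.fracNorm (α / 2) 0 h) := by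
  refine ⟨19, fun α hα M hM h hh ↦ ?_⟩
  obtain ⟨g, hg⟩ := TripleDeck.exists_isFlux h
  have hsol : ∀ f : TripleDeck.L2Strip M, TripleDeck.IsSolution f h →
      f = (TripleDeck.primR M).compLpL 2 volume g := by
    intro f hf
    obtain ⟨g', hg', rfl⟩ := hf.exists_isFlux hM
    rw [hg'.unique hg]
  have hbound := hg.normXInter_le hM α
  have htop : TripleDeck.normXInter 0 α ((TripleDeck.primR M).compLpL 2 volume g) < ⊤ := by
    refine hbound.trans_lt (ENNReal.mul_lt_top (by norm_num) (ENNReal.add_lt_top.2 ⟨?_, ?_⟩))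
    · exact ENNReal.mul_lt_top ENNReal.ofReal_lt_top enorm_lt_top
    · exact TripleDeck.fracNorm_lt_top_of_memSobolev (by positivity) hh
  refine ⟨⟨_, ⟨ENNReal.add_lt_top.1 htop, hg.isSolution hM⟩, fun f hf ↦ hsol f hf.2⟩, ?_⟩
  intro f _ hf
  rw [hsol f hf]
  exact_mod_cast hbound
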